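/- Let $C$ be a compact connected Riemann surface of genus $g\ge 2$ with a holomorphic map $f:C\to\mathbb P^1$ of degree $2$ (a hyperelliptic curve), and let $w_1,w_2\in C$ be ramification points of $f$ with $f(w_1)=0$ and $f(w_2)=\infty$. Let $J=H^0(C,K_C)^\vee/\{\text{periods}\}$ be the Jacobian of $C$, let $a:C\to J$, $a(p)=\mathrm{class}(p-w_1)$, be the Abel–Jacobi embedding, and let $K=W_1\otimes f+W_2\otimes f$ be the basic higher cycle, where $W_1=a(C)$ and $W_2=a(C)+\mathrm{class}(w_2-w_1)$, both parametrized by $C$. Its real regulator is the current $$\langle R(K),\Omega\rangle=(2\pi\sqrt{-1})^{-1}\sum_{i=1,2}\int_{W_i}\Omega\,\log|f| .$$ For a basis $\omega_1,\dots,\omega_g$ of the holomorphic one-forms on $J$ whose pull-backs $\zeta_i=a^*\omega_i$ are orthonormal for $\langle\alpha,\beta\rangle=\frac i2\int_C\alpha\wedge\bar\beta$, put $\tau=\omega_1\wedge\bar\omega_1-\omega_2\wedge\bar\omega_2$. Then: (1) there is such a basis with $\langle R(K),\tau\rangle\neq 0$; (2) for every such basis, the integral $\int_C\log|f|\,a^*\tau=\int_C\log|f|\,(\zeta_1\wedge\bar\zeta_1-\zeta_2\wedge\bar\zeta_2)$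 converges absolutely, and it is nonzero if and only if $\langle R(K),\tau\rangle\ne 0$; moreover, the set of unitary matrices $U\in U(g)$ for which the basis $\omega_i'=\sum_jU_{ij}\omega_j$ satisfies $\langle R(K),\omega_1'\wedge\bar\omega_1'-\omega_2'\wedge\bar\omega_2'\rangle\neq0$ is open and dense in $U(g)$. In particular this holds for a general hyperelliptic curve. -/

import Mathlib

open scoped Manifold Topology
open Set MeasureTheory

noncomputable section

/-! Throughout, a compact Riemann surface is a compact connected Hausdorff space `C` with an atlas of
complex charts whose changes of coordinates are holomorphic (`IsManifold 𝓘(ℂ) 1 C`). -/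

namespace RiemannSurface

/-! ### Exterior algebra of a real vector space in degree two -/

/-- The wedge product `α ∧ β` of two complex valued real-linear forms. -/
def wedge {E : Type*} [AddCommGroup E] [Module ℝ E] (α β : E →ₗ[ℝ] ℂ) : E [⋀^Fin 2]→ₗ[ℝ] ℂ where
  toFun v := α (v 0) * β (v 1) - α (v 1) * β (v 0)
  map_update_add' := by
    intro _ m i x y
    fin_cases i <;> simp <;> ring
  map_update_smul' := by
    intro _ m i c x
    fin_cases i <;> simp <;> ring
  map_eq_zero_of_eq' := by
    intro v i j h hij
    fin_cases i <;> fin_cases j <;> simp_all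

/-- The form `v ↦ conj (α v)`. -/
def conjForm {E : Type*} [AddCommGroup E] [Module ℝ E] (α : E →ₗ[ℝ] ℂ) : E →ₗ[ℝ] ℂ :=
  Complex.conjAe.toLinearMap ∘ₗ α

/-- `α ∧ conj β` for complex-linear forms `α`, `β`. -/
def wedgeConj {E : Type*} [AddCommGroup E] [Module ℂ E] (α β : E →ₗ[ℂ] ℂ) :
    E [⋀^Fin 2]→ₗ[ℝ] ℂ :=
  wedge (α.restrictScalars ℝ) (conjForm (β.restrictScalars ℝ))

section Surface

variable (C : Type*) [TopologicalSpace C] [ChartedSpace ℂ C]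

/-! ### Holomorphic one-forms -/

variable {C} in
/-- The tangent vector of `C` with coordinate `c` in the chart `e`, at the point with coordinate `z`
(so `c = 1` is `∂/∂x` and `c = i` is `∂/∂y`, for `z = x + i y`). -/
def coordVec (e : OpenPartialHomeomorph C ℂ) (z c : ℂ) : TangentSpace 𝓘(ℂ) (e.symm z) :=
  mfderiv 𝓘(ℂ) 𝓘(ℂ) e.symm z c

/-- The holomorphic one-forms on `C`: families of covectors whose coefficient with respect to `dz`
is a holomorphic function of `z` in every chart `z`. -/
def holForms : Submodule ℂ (∀ p : C, TangentSpace 𝓘(ℂ) p →L[ℂ] ℂ) where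
  carrier := {η | ∀ e ∈ atlas ℂ C, DifferentiableOn ℂ
    (fun z : ℂ => η (e.symm z) (coordVec e z 1)) e.target}
  add_mem' := fun ha hb e he => (ha e he).add (hb e he)
  zero_mem' := fun _ _ => differentiableOn_const (0 : ℂ)
  smul_mem' := fun c _ ha e he => (ha e he).const_smul c

/-! ### Integration of two-forms -/

/-- Two-forms on `C`, with complex values and without any regularity. -/
abbrev TwoForm : Type _ := ∀ p : C, TangentSpace 𝓘(ℂ) p [⋀^Fin 2]→ₗ[ℝ] ℂ

variable {C}

/-- The coefficient of `dx ∧ dy` of a two-form in the chart `z = x + i y`. -/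
def TwoForm.coeff (β : TwoForm C) (e : OpenPartialHomeomorph C ℂ) (z : ℂ) : ℂ :=
  β (e.symm z) ![coordVec e z 1, coordVec e z Complex.I]

variable (C) in
theorem exists_chartPartition [CompactSpace C] [T2Space C] :
    ∃ ρ : PartitionOfUnity C C, ρ.IsSubordinate fun p => (chartAt ℂ p).source :=
  PartitionOfUnity.exists_isSubordinate isClosed_univ _ (fun p => (chartAt ℂ p).open_source)
    fun p _ => mem_iUnion.2 ⟨p, mem_chart_source ℂ p⟩

variable (C) in
/-- A continuous partition of unity subordinate to the covering by the preferred charts. -/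
def chartPartition [CompactSpace C] [T2Space C] : PartitionOfUnity C C :=
  (exists_chartPartition C).choose

/-- The integral of a two-form over `C`. By compactness only finitely many summands are nonzero. -/
def TwoForm.integral [CompactSpace C] [T2Space C] (β : TwoForm C) : ℂ :=
  ∑ᶠ i : C, ∫ z in (chartAt ℂ i).target,
    (chartPartition C i ((chartAt ℂ i).symm z) : ℂ) * β.coeff (chartAt ℂ i) z

/-- Absolute convergence of the integral of a two-form over `C`. -/
def TwoForm.IsIntegrable [CompactSpace C] [T2Space C] (β : TwoForm C) : Prop :=
  ∀ i : C, IntegrableOn (fun z : ℂ =>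
    (chartPartition C i ((chartAt ℂ i).symm z) : ℂ) * β.coeff (chartAt ℂ i) z)
    (chartAt ℂ i).target

/-- The inner product `(i/2) ∫_C α ∧ conj β` of two families of covectors of type `(1,0)`. -/
def formInner [CompactSpace C] [T2Space C] (α β : ∀ p : C, TangentSpace 𝓘(ℂ) p →ₗ[ℂ] ℂ) : ℂ :=
  Complex.I / 2 * TwoForm.integral (fun p => wedgeConj (α p) (β p))

/-! ### Meromorphic functions and double covers of the Riemann sphere -/

/-- The affine coordinate of the Riemann sphere, with value `0` at infinity. -/
def sphereCoord (x : OnePoint ℂ) : ℂ := x.elim 0 id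

/-- The coordinate of the Riemann sphere around infinity. -/
def sphereCoordInv (x : OnePoint ℂ) : ℂ := (sphereCoord x)⁻¹

/-- `log |x|` on the Riemann sphere; the value at `0` and `∞` is immaterial (it is set to zero). -/
def logAbs (x : OnePoint ℂ) : ℝ := Real.log ‖sphereCoord x‖

/-- Holomorphic maps from `C` to the Riemann sphere. -/
structure IsHolomorphicToSphere (f : C → OnePoint ℂ) : Prop where
  continuous : Continuous f
  finite_part : ∀ p, f p ≠ OnePoint.infty →
    MDifferentiableAt 𝓘(ℂ) 𝓘(ℂ) (fun q => sphereCoord (f q)) p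
  infinite_part : ∀ p, f p ≠ ((0 : ℂ) : OnePoint ℂ) →
    MDifferentiableAt 𝓘(ℂ) 𝓘(ℂ) (fun q => sphereCoordInv (f q)) p

/-- Holomorphic maps of degree two to the Riemann sphere: no fibre has more than two points, and
some fibre has two. The ramification points are the points that are alone in their fibre. -/
structure IsDoubleCover (f : C → OnePoint ℂ) : Prop where
  holomorphic : IsHolomorphicToSphere f
  fibre_le : ∀ x, (f ⁻¹' {x}).encard ≤ 2
  fibre_eq : ∃ x, (f ⁻¹' {x}).encard = 2

/-! ### One-chains, periods and the Jacobian -/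

variable (C) in
/-- Paths `[0,1] → C` of class `C¹` (the values outside of `[0,1]` are immaterial). -/
structure C1Path where
  /-- the path -/
  toFun : ℝ → C
  continuousOn : ContinuousOn toFun (Icc 0 1)
  contDiffOn : ∀ e ∈ atlas ℂ C, ContDiffOn ℝ 1 (e ∘ toFun) (Icc 0 1 ∩ toFun ⁻¹' e.source)

/-- The velocity vector of a path; the tangent space of `C` at a point is identified with `ℂ` through
the preferred chart at this point. -/
def C1Path.velocity (γ : C1Path C) (t : ℝ) : TangentSpace 𝓘(ℂ) (γ.toFun t) :=
  (derivWithin (chartAt ℂ (γ.toFun t) ∘ γ.toFun) (Icc 0 1) t : ℂ)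

theorem coordVec_hasDerivAt [IsManifold 𝓘(ℂ) 1 C] {e : OpenPartialHomeomorph C ℂ}
    (he : e ∈ atlas ℂ C) {z : ℂ} (hz : z ∈ e.target) :
    HasDerivAt (chartAt ℂ (e.symm z) ∘ e.symm) (coordVec e z 1 : ℂ) z := by
  have h := mdifferentiableAt_atlas_symm (I := 𝓘(ℂ)) he hz
  have h2 := h.hasMFDerivAt.2
  simp only [writtenInExtChartAt, mfld_simps] at h2
  let L : ℂ →L[ℂ] ℂ := mfderiv 𝓘(ℂ) 𝓘(ℂ) e.symm z
  have h3 : HasFDerivWithinAt (chartAt ℂ (e.symm z) ∘ e.symm) L univ z := h2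
  exact h3.hasFDerivAt_of_univ.hasDerivAt

theorem coordVec_smul (e : OpenPartialHomeomorph C ℂ) (z c : ℂ) :
    coordVec e z c = c • coordVec e z 1 := by
  have h := (mfderiv 𝓘(ℂ) 𝓘(ℂ) e.symm z).map_smul c (1 : ℂ)
  have h1 : c • (1 : ℂ) = c := by simp
  exact (congrArg (coordVec e z) h1).symm.trans h

theorem C1Path.hasDerivWithinAt (γ : C1Path C) {e : OpenPartialHomeomorph C ℂ}
    (he : e ∈ atlas ℂ C) {t : ℝ} (ht : t ∈ Icc (0 : ℝ) 1) (hs : γ.toFun t ∈ e.source) :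
    HasDerivWithinAt (e ∘ γ.toFun) (derivWithin (e ∘ γ.toFun) (Icc 0 1) t) (Icc 0 1) t := by
  have h := (γ.contDiffOn e he t ⟨ht, hs⟩).differentiableWithinAt one_ne_zero
  refine DifferentiableWithinAt.hasDerivWithinAt (h.mono_of_mem_nhdsWithin ?_)
  exact Filter.inter_mem self_mem_nhdsWithin
    (γ.continuousOn t ht (e.open_source.mem_nhds hs))

theorem C1Path.velocity_eq [IsManifold 𝓘(ℂ) 1 C] (γ : C1Path C) {e : OpenPartialHomeomorph C ℂ}
    (he : e ∈ atlas ℂ C) {t : ℝ} (ht : t ∈ Icc (0 : ℝ) 1) (hs : γ.toFun t ∈ e.source)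
    (η : holForms C) :
    η.1 (γ.toFun t) (γ.velocity t) = derivWithin (e ∘ γ.toFun) (Icc 0 1) t *
      η.1 (e.symm (e (γ.toFun t))) (coordVec e (e (γ.toFun t)) 1) := by
  have h1 := γ.hasDerivWithinAt he ht hs
  have hp : e.symm (e (γ.toFun t)) = γ.toFun t := e.left_inv hs
  have h2 := coordVec_hasDerivAt he (e.map_source hs)
  have h3 := h2.scomp_hasDerivWithinAt_of_eq t h1 rfl
  have h4 : HasDerivWithinAt (chartAt ℂ (γ.toFun t) ∘ γ.toFun)
      (derivWithin (e ∘ γ.toFun) (Icc 0 1) t • (coordVec e (e (γ.toFun t)) 1 : ℂ))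
      (Icc 0 1) t := by
    refine h3.congr_of_eventuallyEq ?_ ?_
    · filter_upwards [γ.continuousOn t ht (e.open_source.mem_nhds hs)] with u hu
      simp only [Function.comp_apply, hp]
      rw [e.left_inv hu]
    · simp only [Function.comp_apply, hp]
  have h5 := h4.derivWithin (uniqueDiffOn_Icc zero_lt_one t ht)
  have h6 : ∀ (p q : C) (_ : p = q) (c v w : ℂ), w = c * v →
      η.1 q (w : ℂ) = c * η.1 p (v : ℂ) := by
    rintro p _ rfl c v w rfl
    exact (η.1 p).map_smul c v
  exact h6 _ _ hp _ _ _ h5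

/-- The coefficient of a holomorphic one-form with respect to `dz` in a chart. -/
def holCoeff (η : holForms C) (e : OpenPartialHomeomorph C ℂ) (z : ℂ) : ℂ :=
  η.1 (e.symm z) (coordVec e z 1)

theorem C1Path.continuousOn_integrand [IsManifold 𝓘(ℂ) 1 C] (γ : C1Path C) (η : holForms C) :
    ContinuousOn (fun t => η.1 (γ.toFun t) (γ.velocity t)) (Icc 0 1) := by
  intro t ht
  set e := chartAt ℂ (γ.toFun t)
  have he : e ∈ atlas ℂ C := chart_mem_atlas _ _
  have hs : γ.toFun t ∈ e.source := mem_chart_source _ _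
  have hn : Icc 0 1 ∩ γ.toFun ⁻¹' e.source ∈ 𝓝[Icc 0 1] t :=
    Filter.inter_mem self_mem_nhdsWithin (γ.continuousOn t ht (e.open_source.mem_nhds hs))
  have hc : ContinuousOn (fun u => derivWithin (e ∘ γ.toFun) (Icc 0 1) u *
      holCoeff η e (e (γ.toFun u))) (Icc 0 1 ∩ γ.toFun ⁻¹' e.source) := by
    obtain ⟨O, hO, hO'⟩ := (continuousOn_iff'.1 γ.continuousOn) e.source e.open_source
    have hset : Icc 0 1 ∩ γ.toFun ⁻¹' e.source = Icc 0 1 ∩ O := by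
      rw [inter_comm, hO', inter_comm]
    have huniq : UniqueDiffOn ℝ (Icc (0 : ℝ) 1 ∩ γ.toFun ⁻¹' e.source) := by
      rw [hset]; exact (uniqueDiffOn_Icc zero_lt_one).inter hO
    refine ContinuousOn.mul ?_ ?_
    · refine ((γ.contDiffOn e he).continuousOn_derivWithin huniq le_rfl).congr ?_
      intro u hu
      rw [hset, derivWithin_inter]
      exact hO.mem_nhds (hset ▸ hu).2
    · refine ((η.2 e he).continuousOn).comp ?_ fun u hu => e.map_source hu.2
      exact e.continuousOn.comp (γ.continuousOn.mono inter_subset_left) fun u hu => hu.2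
  have := (hc t ⟨ht, hs⟩).mono_of_mem_nhdsWithin hn
  refine this.congr_of_eventuallyEq ?_ ?_
  · filter_upwards [hn] with u hu using γ.velocity_eq he hu.1 hu.2 η
  · exact γ.velocity_eq he ht hs η

theorem C1Path.intervalIntegrable [IsManifold 𝓘(ℂ) 1 C] (γ : C1Path C) (η : holForms C) :
    IntervalIntegrable (fun t => η.1 (γ.toFun t) (γ.velocity t)) volume 0 1 :=
  ContinuousOn.intervalIntegrable (by simpa using γ.continuousOn_integrand η)

/-- Integration along a path, as a linear form on the holomorphic one-forms. -/
def C1Path.integral [IsManifold 𝓘(ℂ) 1 C] (γ : C1Path C) : Module.Dual ℂ (holForms C) where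
  toFun η := ∫ t in (0 : ℝ)..1, η.1 (γ.toFun t) (γ.velocity t)
  map_add' η η' :=
    intervalIntegral.integral_add (γ.intervalIntegrable η) (γ.intervalIntegrable η')
  map_smul' c _ := intervalIntegral.integral_const_mul c _

/-- The boundary of a one-chain, where one-chains are formal integral combinations of paths. -/
def boundary : FreeAbelianGroup (C1Path C) →+ FreeAbelianGroup C :=
  FreeAbelianGroup.lift fun γ =>
    FreeAbelianGroup.of (γ.toFun 1) - FreeAbelianGroup.of (γ.toFun 0)

/-- Integration along a one-chain. -/
def chainIntegral [IsManifold 𝓘(ℂ) 1 C] :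
    FreeAbelianGroup (C1Path C) →+ Module.Dual ℂ (holForms C) :=
  FreeAbelianGroup.lift C1Path.integral

variable (C) in
/-- The group of periods: the integrals along one-cycles. -/
def periods [IsManifold 𝓘(ℂ) 1 C] : AddSubgroup (Module.Dual ℂ (holForms C)) :=
  (boundary (C := C)).ker.map chainIntegral

variable (C) in
/-- The Jacobian of `C`, dual of the holomorphic one-forms modulo periods. -/
abbrev Jacobian [IsManifold 𝓘(ℂ) 1 C] : Type _ := Module.Dual ℂ (holForms C) ⧸ periods C

/-- Every point `p` has a neighbourhood whose points `q` are joined to `p` by paths such that the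
integral of a holomorphic one-form along them is a primitive of this form as a function of `q`. -/
theorem exists_radial [IsManifold 𝓘(ℂ) 1 C] (p : C) :
    ∃ U : Set C, IsOpen U ∧ p ∈ U ∧ ∃ γ : C → C1Path C,
      (∀ q ∈ U, (γ q).toFun 0 = p ∧ (γ q).toFun 1 = q) ∧
      ∀ q ∈ U, ∀ η : holForms C,
        HasMFDerivAt 𝓘(ℂ) 𝓘(ℂ) (fun x => (γ x).integral η) q (η.1 q) := by
  set e := chartAt ℂ p with hedef
  have he : e ∈ atlas ℂ C := chart_mem_atlas _ _
  have hp : p ∈ e.source := mem_chart_source _ _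
  obtain ⟨r, hr, hball⟩ := Metric.isOpen_iff.1 e.open_target (e p) (e.map_source hp)
  have hsub : ∀ z ∈ Metric.ball (e p) r, ∀ t ∈ Icc (0 : ℝ) 1,
      e p + t * (z - e p) ∈ Metric.ball (e p) r := by
    intro z hz t ht
    have h := (convex_ball (e p) r).add_smul_sub_mem (Metric.mem_ball_self hr) hz ht
    simpa using h
  have hline : ∀ z, ContDiff ℝ 1 fun t : ℝ => e p + t * (z - e p) := fun z =>
    contDiff_const.add (Complex.ofRealCLM.contDiff.mul contDiff_const)
  -- the radial path
  let mk (z : ℂ) (hz : z ∈ Metric.ball (e p) r) : C1Path C :=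
    { toFun := fun t => e.symm (e p + t * (z - e p))
      continuousOn := e.continuousOn_symm.comp (hline z).continuous.continuousOn
        fun t ht => hball (hsub z hz t ht)
      contDiffOn := by
        intro e' he'
        have h1 : ContDiffOn ℂ 1 (e' ∘ e.symm) (e.symm ≫ₕ e').source :=
           contMDiffOn_iff_contDiffOn.1
            (contMDiffOn_of_mem_contDiffGroupoid (HasGroupoid.compatible he he'))
        refine ((h1.restrict_scalars ℝ).comp (hline z).contDiffOn
          (t := (e.symm ≫ₕ e').source) ?_)
        intro t ht
        simp only [mfld_simps]
        exact ⟨hball (hsub z hz t ht.1), ht.2⟩ }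
  have hU : IsOpen (e.source ∩ e ⁻¹' Metric.ball (e p) r) :=
    e.isOpen_inter_preimage Metric.isOpen_ball
  classical
  let c0 : C1Path C := mk (e p) (Metric.mem_ball_self hr)
  refine ⟨_, hU, ⟨hp, Metric.mem_ball_self hr⟩,
    fun q => if h : e q ∈ Metric.ball (e p) r then mk (e q) h else c0, ?_, ?_⟩
  · rintro q ⟨hq, hq'⟩
    have hq'' : e q ∈ Metric.ball (e p) r := hq'
    simp only [hq'', dite_true, mk]
    simp [e.left_inv hp, e.left_inv hq]
  · rintro q ⟨hq, hq'⟩ η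
    obtain ⟨F, hF⟩ : ∃ F : ℂ → ℂ, ∀ z ∈ Metric.ball (e p) r, HasDerivAt F (holCoeff η e z) z :=
      (DifferentiableOn.mono (η.2 e he) hball).isExactOn_ball
    have hint : ∀ z (hz : z ∈ Metric.ball (e p) r), (mk z hz).integral η = F z - F (e p) := by
      intro z hz
      set γ := mk z hz with hγ
      have hsrc : ∀ t ∈ Icc (0 : ℝ) 1, γ.toFun t ∈ e.source := fun t ht =>
        e.map_target (hball (hsub z hz t ht))
      have hval : ∀ t ∈ Icc (0 : ℝ) 1, e (γ.toFun t) = e p + t * (z - e p) := fun t ht =>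
        e.right_inv (hball (hsub z hz t ht))
      have hd : ∀ t ∈ Icc (0 : ℝ) 1, HasDerivWithinAt (fun t => F (e (γ.toFun t)))
          (η.1 (γ.toFun t) (γ.velocity t)) (Icc 0 1) t := by
        intro t ht
        rw [γ.velocity_eq he ht (hsrc t ht) η]
        have h1 := hF (e (γ.toFun t)) (by rw [hval t ht]; exact hsub z hz t ht)
        exact h1.scomp_hasDerivWithinAt_of_eq t (γ.hasDerivWithinAt he ht (hsrc t ht)) rfl
      have := intervalIntegral.integral_eq_sub_of_hasDerivAt_of_le zero_le_one
        (fun t ht => (hd t ht).continuousWithinAt)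
        (fun t ht => (hd t (Ioo_subset_Icc_self ht)).hasDerivAt (Icc_mem_nhds ht.1 ht.2))
        (γ.intervalIntegrable η)
      rw [hval 0 (by simp), hval 1 (by simp)] at this
      simp only [Complex.ofReal_one, Complex.ofReal_zero, one_mul, zero_mul, add_zero,
        add_sub_cancel] at this
      exact this
    have hq'' : e q ∈ Metric.ball (e p) r := hq'
    have hFe : HasMFDerivAt 𝓘(ℂ) 𝓘(ℂ) (fun x => F (e x) - F (e p)) q (η.1 q) := by
      have hm := mdifferentiable_of_mem_atlas (I := 𝓘(ℂ)) he
      have hd : HasDerivAt (fun z => F z - F (e p)) (holCoeff η e (e q)) (e q) :=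
        (hF _ hq'').sub_const _
      have hc := HasMFDerivAt.comp q (I' := 𝓘(ℂ)) hd.hasFDerivAt.hasMFDerivAt
        (hm.mdifferentiableAt hq).hasMFDerivAt
      have hL : ∀ v : TangentSpace 𝓘(ℂ) q, η.1 q v =
          (show ℂ from mfderiv 𝓘(ℂ) 𝓘(ℂ) e q v) * holCoeff η e (e q) := by
        intro v
        have hv := DFunLike.congr_fun (hm.symm_comp_deriv hq) v
        have hv' : (coordVec e (e q) (mfderiv 𝓘(ℂ) 𝓘(ℂ) e q v) : ℂ) = v := hv
        have h6 : ∀ (x y : C) (_ : x = y) (u w : ℂ), u = w → η.1 x (u : ℂ) = η.1 y (w : ℂ) := by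
          rintro x _ rfl u _ rfl; rfl
        refine (h6 _ _ (e.left_inv hq) _ _ hv').symm.trans ?_
        refine (congrArg (η.1 (e.symm (e q))) (coordVec_smul e (e q) _)).trans ?_
        exact (η.1 _).map_smul _ _
      have hE : η.1 q = (ContinuousLinearMap.toSpanSingleton ℂ (holCoeff η e (e q)) : ℂ →L[ℂ] ℂ).comp
          (show TangentSpace 𝓘(ℂ) q →L[ℂ] ℂ from mfderiv 𝓘(ℂ) 𝓘(ℂ) e q) :=
        ContinuousLinearMap.ext hL
      rw [hE]
      exact hc
    refine hFe.congr_of_eventuallyEq ?_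
    filter_upwards [hU.mem_nhds ⟨hq, hq'⟩] with x hx
    have hx' : e x ∈ Metric.ball (e p) r := hx.2
    simp only [hx', dite_true]
    exact hint _ hx'

theorem exists_chain [IsManifold 𝓘(ℂ) 1 C] [ConnectedSpace C] (p q : C) :
    ∃ c : FreeAbelianGroup (C1Path C),
      boundary c = FreeAbelianGroup.of q - FreeAbelianGroup.of p := by
  refine PreconnectedSpace.induction₂' (fun p q : C => ∃ c : FreeAbelianGroup (C1Path C),
      boundary c = FreeAbelianGroup.of q - FreeAbelianGroup.of p) ?_ ⟨?_⟩ p q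
  · intro x
    obtain ⟨U, hU, hx, γ, h1, -⟩ := exists_radial x
    filter_upwards [hU.mem_nhds hx] with y hy
    exact ⟨⟨FreeAbelianGroup.of (γ y), by simp [boundary, h1 y hy]⟩,
      ⟨-FreeAbelianGroup.of (γ y), by simp [boundary, h1 y hy]⟩⟩
  · rintro x y z ⟨c, hc⟩ ⟨d, hd⟩
    exact ⟨c + d, by rw [map_add, hc, hd]; abel⟩

/-- A one-chain from `p` to `q`. -/
def chainFromTo [IsManifold 𝓘(ℂ) 1 C] [ConnectedSpace C] (p q : C) : FreeAbelianGroup (C1Path C) :=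
  (exists_chain p q).choose

theorem boundary_chainFromTo [IsManifold 𝓘(ℂ) 1 C] [ConnectedSpace C] (p q : C) :
    boundary (chainFromTo p q) = FreeAbelianGroup.of q - FreeAbelianGroup.of p :=
  (exists_chain p q).choose_spec

/-! ### Parametrized curves in the Jacobian -/

theorem hasMFDerivAt_add_const {f : C → ℂ} {q : C} {L : TangentSpace 𝓘(ℂ) q →L[ℂ] ℂ}
    (h : HasMFDerivAt 𝓘(ℂ) 𝓘(ℂ) f q L) (c : ℂ) :
    HasMFDerivAt 𝓘(ℂ) 𝓘(ℂ) (fun x => f x + c) q L :=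
  ⟨h.1.add continuousAt_const, h.2.add_const c⟩

variable (C) in
/-- A holomorphic map from `C` to its Jacobian, together with its differential. The tangent space of
the Jacobian at every point is the dual of the space of holomorphic one-forms. Locally the map
lifts to this vector space, and the differential is the derivative of the lift, coordinate by
coordinate. -/
structure JacobianCurve [IsManifold 𝓘(ℂ) 1 C] where
  /-- the map -/
  toFun : C → Jacobian C
  /-- its differential -/
  diff : ∀ p : C, TangentSpace 𝓘(ℂ) p →ₗ[ℂ] Module.Dual ℂ (holForms C)
  exists_lift : ∀ p, ∃ U : Set C, IsOpen U ∧ p ∈ U ∧ ∃ Φ : C → Module.Dual ℂ (holForms C),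
    (∀ q ∈ U, (Φ q : Jacobian C) = toFun q) ∧
    ∀ q ∈ U, ∀ η : holForms C, ∃ L : TangentSpace 𝓘(ℂ) q →L[ℂ] ℂ,
      HasMFDerivAt 𝓘(ℂ) 𝓘(ℂ) (fun x => Φ x η) q L ∧ ∀ v, L v = diff q v η

/-- The translate of a curve in the Jacobian. -/
def JacobianCurve.translate [IsManifold 𝓘(ℂ) 1 C] (W : JacobianCurve C) (t : Jacobian C) :
    JacobianCurve C where
  toFun p := W.toFun p + t
  diff := W.diff
  exists_lift := by
    intro p
    obtain ⟨U, hU, hp, Φ, h1, h2⟩ := W.exists_lift p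
    obtain ⟨s, rfl⟩ := QuotientAddGroup.mk_surjective t
    refine ⟨U, hU, hp, fun q => Φ q + s, fun q hq => by simp [← h1 q hq], fun q hq η => ?_⟩
    obtain ⟨L, hL, hL'⟩ := h2 q hq η
    exact ⟨L, hasMFDerivAt_add_const hL (s η), hL'⟩

/-- The Abel-Jacobi embedding with base point `p₀`, mapping `p` to the integration along paths
from `p₀` to `p`; in terms of divisors this is the class of `p - p₀`. -/
def abelJacobi [IsManifold 𝓘(ℂ) 1 C] [ConnectedSpace C] (p₀ : C) : JacobianCurve C where
  toFun p := (chainIntegral (chainFromTo p₀ p) : Jacobian C)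
  diff p :=
    { toFun := fun v =>
        { toFun := fun η => η.1 p v
          map_add' := fun _ _ => rfl
          map_smul' := fun _ _ => rfl }
      map_add' := fun v w => LinearMap.ext fun η => (η.1 p).map_add v w
      map_smul' := fun c v => LinearMap.ext fun η => (η.1 p).map_smul c v }
  exists_lift := by
    intro p
    obtain ⟨U, hU, hp, γ, h1, h2⟩ := exists_radial p
    refine ⟨U, hU, hp, fun q => chainIntegral (chainFromTo p₀ p) + (γ q).integral, ?_, ?_⟩
    · intro q hq
      refine QuotientAddGroup.eq.2 ?_
      refine ⟨-(chainFromTo p₀ p + FreeAbelianGroup.of (γ q)) + chainFromTo p₀ q, ?_, ?_⟩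
      · have hb : boundary (FreeAbelianGroup.of (γ q)) =
            FreeAbelianGroup.of q - FreeAbelianGroup.of p := by simp [boundary, h1 q hq]
        refine AddMonoidHom.mem_ker.2 ?_
        rw [map_add, map_neg, map_add, boundary_chainFromTo, boundary_chainFromTo, hb]
        abel
      · simp [chainIntegral]
    · intro q hq η
      refine ⟨η.1 q, ?_, fun v => rfl⟩
      have h := hasMFDerivAt_add_const (h2 q hq η) (chainIntegral (chainFromTo p₀ p) η)
      have hcomm : (fun x => (chainIntegral (chainFromTo p₀ p) + (γ x).integral) η) =
          fun x => (γ x).integral η + chainIntegral (chainFromTo p₀ p) η :=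
        funext fun x => add_comm _ _
      rw [hcomm]
      exact h

/-! ### Translation invariant forms on the Jacobian, and pull-back to the curve -/

variable (C) in
/-- The holomorphic one-forms on the Jacobian. They are translation invariant, hence are the linear
forms on its tangent space. -/
abbrev JacobianOneForm : Type _ := Module.Dual ℂ (Module.Dual ℂ (holForms C))

variable (C) in
/-- Two-forms on the Jacobian, with complex values and without any regularity. -/
abbrev JacobianTwoForm [IsManifold 𝓘(ℂ) 1 C] : Type _ :=
  Jacobian C → Module.Dual ℂ (holForms C) [⋀^Fin 2]→ₗ[ℝ] ℂ

/-- The pull-back of a one-form on the Jacobian. -/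
def JacobianCurve.pullOne [IsManifold 𝓘(ℂ) 1 C] (W : JacobianCurve C) (α : JacobianOneForm C)
    (p : C) : TangentSpace 𝓘(ℂ) p →ₗ[ℂ] ℂ :=
  α ∘ₗ W.diff p

/-- The pull-back of a two-form on the Jacobian. -/
def JacobianCurve.pullTwo [IsManifold 𝓘(ℂ) 1 C] (W : JacobianCurve C) (Ω : JacobianTwoForm C) :
    TwoForm C :=
  fun p => (Ω (W.toFun p)).compLinearMap ((W.diff p).restrictScalars ℝ)

/-- The product `log |f| β` of a two-form `β` on `C` with the function `log |f|`. -/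
def logTimes (f : C → OnePoint ℂ) (β : TwoForm C) : TwoForm C :=
  fun p => logAbs (f p) • β p

/-- The one-forms `ω i` on the Jacobian pull back to an orthonormal system under the Abel-Jacobi
embedding with base point `p₀`. -/
def IsOrthonormalFrame [IsManifold 𝓘(ℂ) 1 C] [CompactSpace C] [T2Space C] [ConnectedSpace C]
    (p₀ : C) {g : ℕ} (ω : Fin g → JacobianOneForm C) : Prop :=
  ∀ i j, formInner ((abelJacobi p₀).pullOne (ω i)) ((abelJacobi p₀).pullOne (ω j)) =
    if i = j then 1 else 0

/-- The invariant two-form `α ∧ conj α - β ∧ conj β` on the Jacobian. -/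
def tauForm [IsManifold 𝓘(ℂ) 1 C] (α β : JacobianOneForm C) : JacobianTwoForm C :=
  fun _ => wedgeConj α α - wedgeConj β β

/-! ### Higher cycles supported on curves, and their real regulator -/

variable (C) in
/-- Formal sums of symbols `W ⊗ f`, where `W` is a curve in the Jacobian parametrized by `C` and `f`
is a function on `C`. -/
abbrev HigherChain [IsManifold 𝓘(ℂ) 1 C] : Type _ :=
  FreeAbelianGroup (JacobianCurve C × (C → OnePoint ℂ))

/-- The real regulator of `∑ Wᵢ ⊗ fᵢ`, as a current acting on two-forms on the Jacobian:
`Ω ↦ (2 π i) ^ (k - 1 - d) * ∑ ∫_{Wᵢ} log |fᵢ| Ω`. Here `k`, the codimension of the cycle, equals `d`, the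
dimension of the Jacobian. -/
def realRegulator [IsManifold 𝓘(ℂ) 1 C] [CompactSpace C] [T2Space C] :
    HigherChain C →+ (JacobianTwoForm C → ℂ) :=
  FreeAbelianGroup.lift fun x Ω =>
    (2 * Real.pi * Complex.I)⁻¹ * (logTimes x.2 (x.1.pullTwo Ω)).integral

/-- The basic cycle `W₁ ⊗ f + W₂ ⊗ f`, where `W₁` is the image of `C` in the Jacobian under the
Abel-Jacobi embedding with base point `w₁`, and `W₂` is its translate by the class of `w₂ - w₁`. -/
def basicCycle [IsManifold 𝓘(ℂ) 1 C] [ConnectedSpace C] (f : C → OnePoint ℂ) (w₁ w₂ : C) :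
    HigherChain C :=
  FreeAbelianGroup.of (abelJacobi w₁, f) +
    FreeAbelianGroup.of ((abelJacobi w₁).translate ((abelJacobi w₁).toFun w₂), f)

end Surface

end RiemannSurface

end

open RiemannSurface

/-!
For holomorphic one-forms on `C`, put `h(ζ, η) = (i/2) ∫ log |f| ζ ∧ conj η`, a Hermitian form.
The translation by the class of `w₂ - w₁` does not change a form on the Jacobian, so both
components of the cycle contribute equally to the regulator of `τ`, which is therefore a nonzero
multiple of `h(ζ₁, ζ₁) - h(ζ₂, ζ₂)`. Passing to another orthonormal basis by a unitary matrix `U`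
replaces the Gram matrix `H` of `h` by `U H Uᴴ`, and the condition says that the first two
diagonal entries of this matrix differ. The set of such `U` is open. If `H` is not a scalar
matrix, it is nonempty, by diagonalization, and dense, because up to a scalar any two unitary
matrices are joined by an analytic path `t ↦ exp (i t X) U` (`Matrix.dense_unitary_diag_ne`).

It remains to see that `h` is not a real multiple `c` of the inner product
(`RiemannSurface.IsHolomorphicToSphere.exists_weightedInner_ne`). There are holomorphic one-forms
`η ≠ 0` and `ζ` with `ζ = f η`. If `h` were `c` times the inner product, then
`(i/2) ∫ (log |f| - c) (|f| ^ 2 - exp c ^ 2) η ∧ conj η = 0`, as one sees on combining the relations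
for `ζ` and `η`. But the two factors always have the same sign, so the integral is positive.

The pair `η`, `ζ` is found without the equation of the hyperelliptic curve
(`RiemannSurface.IsHolomorphicToSphere.exists_holForms_mul`). As the genus is at least two, some
`η ≠ 0` vanishes at the pole `w₂` of `f`. The trace of `η` to the sphere is zero: in the affine
coordinate, the sum of `η / df` over the fibres of `f` is holomorphic off the branch points, its
singularities there are milder than simple poles, and it tends to zero at infinity, so that it
vanishes by the theorem of Liouville
(`RiemannSurface.IsHolomorphicToSphere.exists_fibreTrace_eq_zero`). In a local parameter `t` with
`f = 1 / t ^ 2`, this means that `η = H(t) dt` with `H` even. Hence `η`, which vanishes at `w₂`,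
does so to the second order, and `f η` is holomorphic.
-/

/-! ### Unitary matrices and diagonal entries -/

namespace Matrix

open scoped Matrix.Norms.L2Operator

variable {n : Type*} [Fintype n] [DecidableEq n]

/-- If a Hermitian matrix `H` is not scalar, some unitary conjugate of it has distinct entries at
two given places of the diagonal: diagonalize `H`, and permute the eigenvalues. -/
theorem exists_unitary_diag_ne {H : Matrix n n ℂ} (hH : H.IsHermitian)
    (hns : ∀ c : ℝ, H ≠ (c : ℂ) • (1 : Matrix n n ℂ)) {i j : n} (hij : i ≠ j) :
    ∃ V : unitaryGroup n ℂ, (V.1 * H * star V.1) i i ≠ (V.1 * H * star V.1) j j := by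
  obtain ⟨a, b, hab⟩ : ∃ a b, hH.eigenvalues a ≠ hH.eigenvalues b := by
    by_contra! hcon
    apply hns (hH.eigenvalues i)
    have h := hH.spectral_theorem
    have hd : diagonal (RCLike.ofReal ∘ hH.eigenvalues : n → ℂ) =
        ((hH.eigenvalues i : ℝ) : ℂ) • (1 : Matrix n n ℂ) := by
      rw [smul_one_eq_diagonal]
      congr 1
      funext k
      simp [hcon k i]
    rw [hd, map_smul, map_one] at h
    exact h
  have hne : a ≠ b := fun h => hab (by rw [h])
  obtain ⟨σ, hσi, hσj⟩ : ∃ σ : Equiv.Perm n, σ i = a ∧ σ j = b := by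
    refine ⟨(Equiv.swap i a).trans (Equiv.swap (Equiv.swap i a j) b), ?_, ?_⟩
    · have : a ≠ Equiv.swap i a j := by
        intro h
        have := congrArg (Equiv.swap i a) h
        simp at this
        exact hij this
      simp [Equiv.swap_apply_of_ne_of_ne this hne]
    · simp
  set W := hH.eigenvectorUnitary with hW
  have hdiag : star W.1 * H * W.1 = diagonal (RCLike.ofReal ∘ hH.eigenvalues : n → ℂ) := by
    have h := hH.spectral_theorem
    rw [Unitary.conjStarAlgAut_apply] at h
    have h1 : star W.1 * W.1 = 1 := Unitary.coe_star_mul_self W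
    conv_lhs => rw [h]
    rw [← hW]
    simp only [mul_assoc]
    rw [h1, mul_one, ← mul_assoc, h1, one_mul]
  let V : Matrix n n ℂ := (star W.1).submatrix σ id
  have hVstar : star V = W.1.submatrix id σ := by
    ext k l
    simp [V, star_apply]
  have hV : V ∈ unitaryGroup n ℂ := by
    rw [mem_unitaryGroup_iff, hVstar]
    have h2 := submatrix_mul_equiv (star W.1) W.1 σ (Equiv.refl n) σ
    have h1 : star W.1 * W.1 = 1 := Unitary.coe_star_mul_self W
    rw [h1] at h2
    simpa using h2
  refine ⟨⟨V, hV⟩, ?_⟩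
  have h3 : V * H * star V = (diagonal (RCLike.ofReal ∘ hH.eigenvalues : n → ℂ)).submatrix σ σ := by
    rw [hVstar, ← hdiag]
    ext k l
    simp [V, Matrix.mul_apply]
  have h4 : ∀ k, (V * H * star V) k k = (hH.eigenvalues (σ k) : ℂ) := by
    intro k; rw [h3]; simp
  change (V * H * star V) i i ≠ (V * H * star V) j j
  rw [h4, h4, hσi, hσj]
  exact_mod_cast hab

/-- Up to a scalar, any two unitary matrices are joined by a one-parameter group. The scalar
serves to move the spectrum of `V Uᴴ` away from `-1`, where the principal logarithm is not
continuous. -/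
theorem exists_smul_eq_exp_mul (U V : unitaryGroup n ℂ) :
    ∃ (c : ℂ) (X : Matrix n n ℂ), c * star c = 1 ∧ IsSelfAdjoint X ∧
      c • V.1 = NormedSpace.exp (Complex.I • X) * U.1 := by
  have hfin : (spectrum ℂ (V.1 * star U.1)).Finite := Matrix.finite_spectrum _
  obtain ⟨c, hc⟩ : ∃ c : Circle, (-(c⁻¹ : Circle) : ℂ) ∉ spectrum ℂ (V.1 * star U.1) := by
    by_contra! hcon
    have hinj : Function.Injective fun c : Circle => (-(c⁻¹ : Circle) : ℂ) := by
      intro c d h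
      exact inv_injective (Circle.coe_injective (neg_injective h))
    have : Infinite Circle := by
      have := (Set.Ioc_infinite (a := -Real.pi) (b := Real.pi)
        (by linarith [Real.pi_pos])).to_subtype
      exact Circle.argEquiv.infinite_iff.2 this
    have := Set.infinite_range_of_injective hinj
    exact this (hfin.subset (by rintro _ ⟨c, rfl⟩; exact hcon c))
  let M : Matrix n n ℂ := (c : ℂ) • (V.1 * star U.1)
  have hcc : (c : ℂ) * star (c : ℂ) = 1 := by
    simp [Complex.mul_conj, Complex.normSq_eq_norm_sq, Circle.norm_coe]
  have hM : M ∈ unitary (Matrix n n ℂ) := by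
    have h0 : V.1 * star U.1 ∈ unitary (Matrix n n ℂ) := (V * star U).2
    have hcc' : star (c : ℂ) * (c : ℂ) = 1 := by rw [mul_comm]; exact hcc
    rw [Unitary.mem_iff] at h0 ⊢
    simp only [M, star_smul, smul_mul_smul_comm, hcc, hcc', h0, one_smul, and_self]
  have hspec : (-1 : ℂ) ∉ spectrum ℂ M := by
    intro h
    apply hc
    let r : ℂˣ := Units.mk0 (c : ℂ) (Circle.coe_ne_zero c)
    have h1 := (spectrum.smul_mem_smul_iff (a := V.1 * star U.1) (r := r)
      (s := (-(c⁻¹ : Circle) : ℂ))).1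
    apply h1
    have h2 : r • (-(c⁻¹ : Circle) : ℂ) = -1 := by
      simp [r, Units.smul_def]
    rw [h2]
    exact h
  have hlt : ‖(M - 1 : Matrix n n ℂ)‖ < 2 := (Unitary.norm_sub_one_lt_two_iff hM).2 hspec
  have hexp := expUnitary_argSelfAdjoint (u := ⟨M, hM⟩) hlt
  refine ⟨c, (Unitary.argSelfAdjoint (⟨M, hM⟩ : unitary (Matrix n n ℂ))).1, hcc,
    (Unitary.argSelfAdjoint (⟨M, hM⟩ : unitary (Matrix n n ℂ))).2, ?_⟩
  have h1 := congrArg Subtype.val hexp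
  rw [selfAdjoint.expUnitary_coe] at h1
  rw [h1]
  have hU : star U.1 * U.1 = 1 := Unitary.coe_star_mul_self U
  simp [M, mul_assoc, hU]

/-- The unitary conjugates of a nonscalar Hermitian matrix generically have distinct entries at
two given places of the diagonal: the difference of the entries is analytic along the path from
`U` to a matrix where it is nonzero, so it does not vanish near `U`. -/
theorem dense_unitary_diag_ne {H : Matrix n n ℂ} (hH : H.IsHermitian)
    (hns : ∀ c : ℝ, H ≠ (c : ℂ) • (1 : Matrix n n ℂ)) {i j : n} (hij : i ≠ j) :
    Dense {U : unitaryGroup n ℂ | (U.1 * H * star U.1) i i ≠ (U.1 * H * star U.1) j j} := by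
  obtain ⟨V, hV⟩ := exists_unitary_diag_ne hH hns hij
  intro U
  by_contra hU
  obtain ⟨c, X, hc, hX, hcX⟩ := exists_smul_eq_exp_mul U V
  have hXt : ∀ t : ℝ, IsSelfAdjoint (t • X) := fun t => IsSelfAdjoint.smul (IsSelfAdjoint.all t) hX
  let E : ℝ → Matrix n n ℂ := fun t => NormedSpace.exp (t • (Complex.I • X))
  have hE : ∀ t, E t = selfAdjoint.expUnitary ⟨t • X, hXt t⟩ := by
    intro t
    rw [selfAdjoint.expUnitary_coe]
    simp only [E]
    rw [smul_comm]
  have hstar : ∀ t, star (E t) = E (-t) := by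
    intro t
    simp only [E]
    rw [NormedSpace.star_exp]
    congr 1
    simp [star_smul, hX.star_eq]
  have hEan : AnalyticOnNhd ℝ E univ := by
    intro t _
    exact (NormedSpace.exp_analytic (𝕂 := ℝ) _).comp
      (((ContinuousLinearMap.id ℝ ℝ).smulRight (Complex.I • X)).analyticAt t)
  have hEnan : AnalyticOnNhd ℝ (fun t => E (-t)) univ := by
    intro t _
    exact (hEan (-t) trivial).comp (f := fun t : ℝ => -t) analyticAt_id.neg
  let γ : ℝ → unitaryGroup n ℂ := fun t => selfAdjoint.expUnitary ⟨t • X, hXt t⟩ * U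
  have hγ : ∀ t, (γ t).1 = E t * U.1 := by
    intro t
    rw [hE]; rfl
  let entry : n → Matrix n n ℂ →L[ℝ] ℂ := fun k =>
    LinearMap.toContinuousLinearMap ((Matrix.entryLinearMap ℝ ℂ k k))
  let F : ℝ → ℂ := fun t => entry i (E t * (U.1 * H * star U.1) * E (-t)) -
    entry j (E t * (U.1 * H * star U.1) * E (-t))
  have hF : ∀ t, F t = ((γ t).1 * H * star (γ t).1) i i - ((γ t).1 * H * star (γ t).1) j j := by
    intro t
    rw [hγ, star_mul, hstar]
    simp only [F, entry, LinearMap.coe_toContinuousLinearMap', entryLinearMap_apply, mul_assoc]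
  have hFan : AnalyticOnNhd ℝ F univ := by
    have h1 : AnalyticOnNhd ℝ (fun t => E t * (U.1 * H * star U.1) * E (-t)) univ :=
      (hEan.mul analyticOnNhd_const).mul hEnan
    exact ((entry i).comp_analyticOnNhd h1).sub ((entry j).comp_analyticOnNhd h1)
  have hγc : Continuous γ := by
    refine Continuous.subtype_mk ?_ _
    have : Continuous fun t => E t * U.1 :=
      (continuousOn_univ.1 hEan.continuousOn).mul continuous_const
    refine this.congr fun t => ?_
    rw [← hγ]; rfl
  have hγ0 : γ 0 = U := by
    apply Subtype.ext
    rw [hγ]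
    simp [E]
  have hev : ∀ᶠ t in 𝓝 (0 : ℝ), F t = 0 := by
    have h1 : ∀ᶠ V in 𝓝 (γ 0), ¬ (V.1 * H * star V.1) i i ≠ (V.1 * H * star V.1) j j := by
      rw [hγ0]
      rw [mem_closure_iff_frequently, Filter.not_frequently] at hU
      exact hU
    filter_upwards [hγc.continuousAt.eventually h1] with t ht
    rw [hF]
    exact sub_eq_zero.2 (not_not.1 ht)
  have hzero := hFan.eqOn_zero_of_preconnected_of_eventuallyEq_zero isPreconnected_univ
    (mem_univ 0) hev (mem_univ (1 : ℝ))
  -- the path ends at `c • V`, and the scalar drops out of the conjugation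
  rw [hF, hγ] at hzero
  have h1 : E 1 * U.1 = c • V.1 := by simp [E, hcX]
  rw [h1] at hzero
  have h2 : c • V.1 * H * star (c • V.1) = V.1 * H * star V.1 := by
    rw [star_smul, smul_mul_assoc, smul_mul_smul_comm, hc, one_smul]
  rw [h2] at hzero
  exact hV (sub_eq_zero.1 hzero)

theorem isOpen_unitary_diag_ne (H : Matrix n n ℂ) (i j : n) :
    IsOpen {U : unitaryGroup n ℂ | (U.1 * H * star U.1) i i ≠ (U.1 * H * star U.1) j j} := by
  have h : Continuous fun U : unitaryGroup n ℂ => U.1 * H * star U.1 := by fun_prop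
  exact isOpen_ne_fun (h.matrix_elem i i) (h.matrix_elem j j)

end Matrix

namespace RiemannSurface

open Filter

/-! ### Functions of one complex variable -/

theorem exists_eventually_eq_pow_mul {G : ℂ → ℂ} {z₀ : ℂ} (hG : AnalyticAt ℂ G z₀)
    (hnc : ¬ ∀ᶠ z in 𝓝 z₀, G z = G z₀) :
    ∃ (k : ℕ) (h : ℂ → ℂ), AnalyticAt ℂ h z₀ ∧ h z₀ ≠ 0 ∧
      ∀ᶠ z in 𝓝 z₀, G z - G z₀ = (z - z₀) ^ (k + 1) * h z := by
  have hA : AnalyticAt ℂ (fun z => G z - G z₀) z₀ := hG.sub analyticAt_const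
  obtain ⟨k, h, hh, hne, heq⟩ := hA.exists_eventuallyEq_pow_smul_nonzero_iff.2
    (by simpa [sub_eq_zero] using hnc)
  cases k with
  | zero =>
    have := heq.self_of_nhds
    simp at this
    exact absurd this.symm hne
  | succ k => exact ⟨k, h, hh, hne, by simpa using heq⟩

/-- Near a point `z₀`, the derivative of a nonconstant holomorphic function has no other zero, and
`G - G z₀` vanishes to a higher order at `z₀` than the derivative does. -/
theorem deriv_ne_zero_and_tendsto_sub_div_deriv {G : ℂ → ℂ} {z₀ : ℂ} (hG : AnalyticAt ℂ G z₀)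
    (hnc : ¬ ∀ᶠ z in 𝓝 z₀, G z = G z₀) :
    (∀ᶠ z in 𝓝[≠] z₀, deriv G z ≠ 0) ∧
      Tendsto (fun z => (G z - G z₀) / deriv G z) (𝓝 z₀) (𝓝 0) := by
  obtain ⟨k, h, hh, hne, heq⟩ := exists_eventually_eq_pow_mul hG hnc
  set d : ℂ → ℂ := fun z => (k + 1) * h z + (z - z₀) * deriv h z with hd
  have hdc : ContinuousAt d z₀ :=
    (continuousAt_const.mul hh.continuousAt).add
      ((continuousAt_id.sub continuousAt_const).mul hh.deriv.continuousAt)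
  have hd0 : d z₀ ≠ 0 := by
    simp only [hd, sub_self, zero_mul, add_zero]
    exact mul_ne_zero (by exact_mod_cast k.succ_ne_zero) hne
  have hderiv : ∀ᶠ z in 𝓝 z₀, deriv G z = (z - z₀) ^ k * d z := by
    filter_upwards [heq.eventually_nhds, hh.eventually_analyticAt] with z hz hhz
    have h1 : HasDerivAt (fun w => (w - z₀) ^ (k + 1) * h w)
        (((k + 1 : ℕ) : ℂ) * (z - z₀) ^ k * 1 * h z + (z - z₀) ^ (k + 1) * deriv h z) z := by
      have h2 := ((hasDerivAt_id z).sub_const z₀).pow (k + 1)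
      exact h2.mul hhz.differentiableAt.hasDerivAt
    have h3 : HasDerivAt (fun w => G w - G z₀)
        (((k + 1 : ℕ) : ℂ) * (z - z₀) ^ k * 1 * h z + (z - z₀) ^ (k + 1) * deriv h z) z :=
      h1.congr_of_eventuallyEq hz
    have h4 := h3.deriv
    rw [deriv_sub_const] at h4
    rw [h4, hd]
    push_cast
    ring
  have hdne : ∀ᶠ z in 𝓝 z₀, d z ≠ 0 := hdc.eventually_ne hd0
  refine ⟨?_, ?_⟩
  · filter_upwards [nhdsWithin_le_nhds hderiv, nhdsWithin_le_nhds hdne, self_mem_nhdsWithin]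
      with z h1 h2 h3
    rw [h1]
    exact mul_ne_zero (pow_ne_zero _ (sub_ne_zero.2 h3)) h2
  · have hlim : Tendsto (fun z => (z - z₀) * h z / d z) (𝓝 z₀) (𝓝 ((z₀ - z₀) * h z₀ / d z₀)) :=
      (((continuousAt_id.sub continuousAt_const).mul hh.continuousAt).div hdc hd0).tendsto
    rw [sub_self, zero_mul, zero_div] at hlim
    refine hlim.congr' ?_
    filter_upwards [heq, hderiv, hdne] with z h1 h2 h3
    rw [h1, h2]
    by_cases hz : z = z₀
    · simp [hz]
    · have := sub_ne_zero.2 hz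
      field_simp
      ring

/-- A nonconstant holomorphic function vanishing at `z₀` is locally a power of a local coordinate
centred at `z₀`. -/
theorem exists_eventually_eq_pow {G : ℂ → ℂ} {z₀ : ℂ} (hG : AnalyticAt ℂ G z₀) (h0 : G z₀ = 0)
    (hnc : ¬ ∀ᶠ z in 𝓝 z₀, G z = 0) :
    ∃ (k : ℕ) (ψ : ℂ → ℂ), AnalyticAt ℂ ψ z₀ ∧ ψ z₀ = 0 ∧ deriv ψ z₀ ≠ 0 ∧
      ∀ᶠ z in 𝓝 z₀, G z = ψ z ^ (k + 1) := by
  obtain ⟨k, h, hh, hne, heq⟩ := exists_eventually_eq_pow_mul hG (by rwa [h0])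
  obtain ⟨c, hc⟩ := IsAlgClosed.exists_pow_nat_eq (h z₀) k.succ_pos
  have hc0 : c ≠ 0 := by
    rintro rfl
    simp at hc
    exact hne hc.symm
  -- a root of `h` near `z₀`, written so that the principal branch is holomorphic there
  set r : ℂ → ℂ := fun z => c * (h z / h z₀) ^ ((k + 1 : ℕ) : ℂ)⁻¹ with hr
  have hra : AnalyticAt ℂ r z₀ := by
    refine analyticAt_const.mul ((hh.div analyticAt_const hne).cpow analyticAt_const ?_)
    rw [Pi.div_apply, div_self hne]
    exact Complex.one_mem_slitPlane
  have hr0 : r z₀ = c := by simp [hr, div_self hne]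
  have hrp : ∀ z, r z ^ (k + 1) = h z := by
    intro z
    simp only [hr]
    rw [mul_pow, Complex.cpow_nat_inv_pow _ k.succ_ne_zero, hc]
    field_simp
  refine ⟨k, fun z => (z - z₀) * r z, (analyticAt_id.sub analyticAt_const).mul hra, by simp, ?_, ?_⟩
  · have : HasDerivAt (fun z => (z - z₀) * r z) (1 * r z₀ + (z₀ - z₀) * deriv r z₀) z₀ :=
      ((hasDerivAt_id z₀).sub_const z₀).mul hra.differentiableAt.hasDerivAt
    rw [this.deriv]
    simpa [hr0] using hc0
  · filter_upwards [heq] with z hz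
    rw [h0, sub_zero] at hz
    rw [hz, mul_pow, hrp]

/-- A function holomorphic off a finite set, with singularities there that are milder than simple
poles, and tending to zero at infinity, vanishes off this set. -/
theorem eq_zero_of_differentiableOn_compl_finset (B : Finset ℂ) :
    ∀ {T : ℂ → ℂ}, DifferentiableOn ℂ T (↑B)ᶜ →
      (∀ a ∈ B, Tendsto (fun x => (x - a) * T x) (𝓝[≠] a) (𝓝 0)) →
      Tendsto T (cocompact ℂ) (𝓝 0) → ∀ x ∉ B, T x = 0 := by
  classical
  induction B using Finset.induction_on with
  | empty =>
    intro T hT _ h0 x _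
    have hd : Differentiable ℂ T := by simpa [differentiableOn_univ] using hT
    exact hd.apply_eq_of_tendsto_cocompact x h0
  | insert a B ha ih =>
    intro T hT hlim h0 x hx
    have hopen : IsOpen ((↑B : Set ℂ)ᶜ) := B.finite_toSet.isClosed.isOpen_compl
    have hmem : (↑B : Set ℂ)ᶜ ∈ 𝓝 a := hopen.mem_nhds (by simpa using ha)
    have hset : ((↑(insert a B) : Set ℂ))ᶜ = (↑B : Set ℂ)ᶜ \ {a} := by
      ext y; simp [and_comm]
    have hlit : (fun z => T z - T a) =o[𝓝[≠] a] fun z => (z - a)⁻¹ := by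
      rw [Asymptotics.isLittleO_iff_tendsto']
      · have h1 : Tendsto (fun z => (z - a) * T z - (z - a) * T a) (𝓝[≠] a) (𝓝 (0 - 0)) := by
          refine (hlim a (Finset.mem_insert_self _ _)).sub ?_
          have : Tendsto (fun z => (z - a) * T a) (𝓝 a) (𝓝 ((a - a) * T a)) :=
            ((continuous_id.sub continuous_const).mul continuous_const).tendsto a
          rw [sub_self, zero_mul] at this
          exact this.mono_left nhdsWithin_le_nhds
        rw [sub_zero] at h1
        refine h1.congr fun z => ?_
        rw [div_inv_eq_mul]
        ring
      · filter_upwards [self_mem_nhdsWithin] with z hz h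
        exact absurd (inv_eq_zero.1 h) (sub_ne_zero.2 hz)
    have hd := Complex.differentiableOn_update_limUnder_of_isLittleO hmem (hset ▸ hT) hlit
    set T' := Function.update T a (limUnder (𝓝[≠] a) T)
    have hT' : ∀ y ≠ a, T' y = T y := fun y hy => Function.update_of_ne hy _ _
    have hxa : x ≠ a := fun h => hx (h ▸ Finset.mem_insert_self _ _)
    rw [← hT' x hxa]
    refine ih hd ?_ ?_ x (fun h => hx (Finset.mem_insert_of_mem h))
    · intro b hb
      have hba : b ≠ a := fun h => ha (h ▸ hb)
      refine (hlim b (Finset.mem_insert_of_mem hb)).congr' ?_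
      filter_upwards [nhdsWithin_le_nhds (isOpen_ne.mem_nhds hba)] with y hy
      rw [hT' y hy]
    · refine h0.congr' ?_
      have : ({a} : Set ℂ)ᶜ ∈ cocompact ℂ := isCompact_singleton.compl_mem_cocompact
      filter_upwards [this] with y hy
      rw [hT' y hy]

theorem integrableOn_log_norm_ball (z₀ : ℂ) :
    IntegrableOn (fun z : ℂ => Real.log ‖z - z₀‖) (Metric.ball z₀ 1) := by
  have h0 : IntegrableOn (fun z : ℂ => Real.log ‖z‖) (Metric.ball 0 1) := by
    rw [integrableOn_fun_norm_addHaar volume]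
    have h1 : IntegrableOn (fun y : ℝ => y * Real.log y) (Icc 0 1) :=
      Real.continuous_mul_log.continuousOn.integrableOn_compact isCompact_Icc
    simpa [Complex.finrank_real_complex] using h1.mono_set Ioo_subset_Icc_self
  have h2 := (measurePreserving_sub_right (volume : Measure ℂ) z₀).integrableOn_comp_preimage
    (measurableEmbedding_subRight z₀) (f := fun z : ℂ => Real.log ‖z‖) (s := Metric.ball 0 1)
  have h3 : (fun z => z - z₀) ⁻¹' Metric.ball 0 1 = Metric.ball z₀ 1 := by
    ext z; simp [dist_eq_norm]
  rw [h3] at h2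
  exact h2.2 h0

/-- The logarithm of the modulus of a nonzero holomorphic function is locally integrable in the plane. -/
theorem exists_integrableOn_log_norm {G : ℂ → ℂ} {z₀ : ℂ} (hG : AnalyticAt ℂ G z₀)
    (hnc : ¬ ∀ᶠ z in 𝓝 z₀, G z = 0) :
    IntegrableAtFilter (fun z => Real.log ‖G z‖) (𝓝 z₀) := by
  obtain ⟨k, h, hh, hne, heq⟩ := hG.exists_eventuallyEq_pow_smul_nonzero_iff.2 hnc
  have hev : ∀ᶠ z in 𝓝 z₀, G z = (z - z₀) ^ k • h z ∧ AnalyticAt ℂ h z ∧ h z ≠ 0 :=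
    heq.and (hh.eventually_analyticAt.and (hh.continuousAt.eventually_ne hne))
  obtain ⟨r, hr, hball⟩ := Metric.nhds_basis_closedBall.eventually_iff.1 hev
  refine ⟨Metric.ball z₀ (min r 1), Metric.ball_mem_nhds _ (by positivity), ?_⟩
  have h1 : IntegrableOn (fun z => Real.log ‖h z‖) (Metric.ball z₀ (min r 1)) := by
    refine IntegrableOn.mono_set (t := Metric.closedBall z₀ r) ?_
      ((Metric.ball_subset_ball (min_le_left _ _)).trans Metric.ball_subset_closedBall)
    refine ContinuousOn.integrableOn_compact (isCompact_closedBall _ _) ?_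
    exact ContinuousOn.log (fun z hz => (hball hz).2.1.continuousAt.continuousWithinAt.norm)
      fun z hz => norm_ne_zero_iff.2 (hball hz).2.2
  have h2 : IntegrableOn (fun z => (k : ℝ) * Real.log ‖z - z₀‖) (Metric.ball z₀ (min r 1)) :=
    ((integrableOn_log_norm_ball z₀).mono_set
      (Metric.ball_subset_ball (min_le_right _ _))).const_mul _
  refine (h2.add h1).congr ?_
  have hae : ∀ᵐ z ∂(volume.restrict (Metric.ball z₀ (min r 1))), z ≠ z₀ :=
    ae_restrict_of_ae (Measure.ae_ne volume z₀)
  filter_upwards [hae, ae_restrict_mem measurableSet_ball] with z hz hzb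
  have hz' := hball (Metric.ball_subset_closedBall (Metric.ball_subset_ball (min_le_left _ _) hzb))
  simp only [Pi.add_apply]
  rw [hz'.1, norm_smul, norm_pow, Real.log_mul (by simpa [sub_eq_zero] using fun h => absurd h hz)
    (norm_ne_zero_iff.2 hz'.2.2), Real.log_pow]

/-! ### Charts and coefficients of one-forms -/

section Charts

theorem eventually_symm_mem {C : Type*} [TopologicalSpace C] {e : OpenPartialHomeomorph C ℂ} {z : ℂ}
    (hz : z ∈ e.target)
    {U : Set C} (hU : U ∈ 𝓝 (e.symm z)) : ∀ᶠ w in 𝓝 z, w ∈ e.target ∧ e.symm w ∈ U :=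
  (e.open_target.eventually_mem hz).and ((e.symm.continuousAt hz).eventually hU)

variable {C : Type*} [TopologicalSpace C] [ChartedSpace ℂ C]

theorem analyticAt_transition [IsManifold 𝓘(ℂ) 1 C] {e e' : OpenPartialHomeomorph C ℂ}
    (he : e ∈ atlas ℂ C) (he' : e' ∈ atlas ℂ C) {z : ℂ} (hz : z ∈ e.target)
    (hz' : e.symm z ∈ e'.source) : AnalyticAt ℂ (e' ∘ e.symm) z := by
  have h1 : ContDiffOn ℂ 1 (e' ∘ e.symm) (e.symm ≫ₕ e').source :=
    contMDiffOn_iff_contDiffOn.1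
      (contMDiffOn_of_mem_contDiffGroupoid (HasGroupoid.compatible he he'))
  exact (h1.differentiableOn one_ne_zero).analyticAt
    ((e.symm ≫ₕ e').open_source.mem_nhds (by simp [hz, hz']))

/-- The tangent vector `∂/∂z` of the chart `e`, as a complex number: the tangent space at a point
is identified with `ℂ` through the preferred chart at this point. -/
noncomputable def coordFactor (e : OpenPartialHomeomorph C ℂ) (z : ℂ) : ℂ :=
  coordVec e z 1

theorem coordFactor_hasDerivAt [IsManifold 𝓘(ℂ) 1 C] {e : OpenPartialHomeomorph C ℂ}
    (he : e ∈ atlas ℂ C) {z : ℂ} (hz : z ∈ e.target) :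
    HasDerivAt (chartAt ℂ (e.symm z) ∘ e.symm) (coordFactor e z) z :=
  coordVec_hasDerivAt he hz

theorem coordFactor_eq_deriv_mul [IsManifold 𝓘(ℂ) 1 C] {e e' : OpenPartialHomeomorph C ℂ}
    (he : e ∈ atlas ℂ C) (he' : e' ∈ atlas ℂ C) {z : ℂ} (hz : z ∈ e.target)
    (hz' : e.symm z ∈ e'.source) :
    coordFactor e z = deriv (e' ∘ e.symm) z * coordFactor e' (e' (e.symm z)) := by
  have h1 := coordFactor_hasDerivAt he hz
  have h2 := coordFactor_hasDerivAt he' (e'.map_source hz')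
  have hchart : chartAt ℂ (e'.symm (e' (e.symm z))) = chartAt ℂ (e.symm z) := by
    rw [e'.left_inv hz']
  rw [hchart] at h2
  have h3 := (analyticAt_transition he he' hz hz').differentiableAt.hasDerivAt
  have h4 := HasDerivAt.comp z h2 h3
  have h5 : HasDerivAt (chartAt ℂ (e.symm z) ∘ e.symm)
      (coordFactor e' (e' (e.symm z)) * deriv (e' ∘ e.symm) z) z := by
    refine h4.congr_of_eventuallyEq ?_
    filter_upwards [eventually_symm_mem hz (e'.open_source.mem_nhds hz')] with w hw
    simp [e'.left_inv hw.2]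
  rw [mul_comm]
  exact h1.unique h5

theorem deriv_transition_ne_zero [IsManifold 𝓘(ℂ) 1 C] {e e' : OpenPartialHomeomorph C ℂ}
    (he : e ∈ atlas ℂ C) (he' : e' ∈ atlas ℂ C) {z : ℂ} (hz : z ∈ e.target)
    (hz' : e.symm z ∈ e'.source) : deriv (e' ∘ e.symm) z ≠ 0 := by
  have h1 := (analyticAt_transition he he' hz hz').differentiableAt.hasDerivAt
  have h2 := (analyticAt_transition he' he (e'.map_source hz')
    (by rw [e'.left_inv hz']; exact e.map_target hz)).differentiableAt.hasDerivAt
  have h3 := HasDerivAt.comp z h2 h1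
  have h4 : HasDerivAt ((e ∘ e'.symm) ∘ (e' ∘ e.symm)) 1 z := by
    refine (hasDerivAt_id z).congr_of_eventuallyEq ?_
    filter_upwards [eventually_symm_mem hz (e'.open_source.mem_nhds hz')] with w hw
    simp [e'.left_inv hw.2, e.right_inv hw.1]
  intro h
  have h5 := h3.unique h4
  change _ * deriv (e' ∘ e.symm) z = 1 at h5
  rw [h, mul_zero] at h5
  exact zero_ne_one h5

theorem coordFactor_chartAt [IsManifold 𝓘(ℂ) 1 C] (p : C) :
    coordFactor (chartAt ℂ p) (chartAt ℂ p p) = 1 := by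
  have h1 := coordFactor_hasDerivAt (chart_mem_atlas ℂ p) (mem_chart_target ℂ p)
  have hp : (chartAt ℂ p).symm (chartAt ℂ p p) = p := (chartAt ℂ p).left_inv (mem_chart_source ℂ p)
  rw [hp] at h1
  refine h1.unique ((hasDerivAt_id _).congr_of_eventuallyEq ?_)
  filter_upwards [(chartAt ℂ p).open_target.mem_nhds (mem_chart_target ℂ p)] with w hw
  simp [(chartAt ℂ p).right_inv hw]

theorem coordFactor_ne_zero [IsManifold 𝓘(ℂ) 1 C] {e : OpenPartialHomeomorph C ℂ}
    (he : e ∈ atlas ℂ C) {z : ℂ} (hz : z ∈ e.target) : coordFactor e z ≠ 0 := by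
  rw [coordFactor_eq_deriv_mul he (chart_mem_atlas ℂ (e.symm z)) hz (mem_chart_source ℂ _),
    coordFactor_chartAt, mul_one]
  exact deriv_transition_ne_zero he (chart_mem_atlas ℂ (e.symm z)) hz (mem_chart_source ℂ _)

theorem covector_apply_eq_mul {p : C} (L : TangentSpace 𝓘(ℂ) p →L[ℂ] ℂ) (v : ℂ) :
    L v = v * L (1 : ℂ) := by
  have h1 : v • (1 : ℂ) = v := by simp
  exact (congrArg L h1).symm.trans (L.map_smul v (1 : ℂ))

/-- The coefficient of a family of covectors with respect to `dz` in a chart. -/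
noncomputable def formCoeff (η : ∀ p : C, TangentSpace 𝓘(ℂ) p →L[ℂ] ℂ)
    (e : OpenPartialHomeomorph C ℂ) (z : ℂ) : ℂ :=
  η (e.symm z) (coordVec e z 1)

theorem formCoeff_eq_mul (η : ∀ p : C, TangentSpace 𝓘(ℂ) p →L[ℂ] ℂ) (e : OpenPartialHomeomorph C ℂ)
    (z : ℂ) : formCoeff η e z = coordFactor e z * η (e.symm z) (1 : ℂ) :=
  covector_apply_eq_mul (η (e.symm z)) (coordFactor e z)

theorem formCoeff_transition [IsManifold 𝓘(ℂ) 1 C] (η : ∀ p : C, TangentSpace 𝓘(ℂ) p →L[ℂ] ℂ)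
    {e e' : OpenPartialHomeomorph C ℂ} (he : e ∈ atlas ℂ C) (he' : e' ∈ atlas ℂ C) {z : ℂ}
    (hz : z ∈ e.target) (hz' : e.symm z ∈ e'.source) :
    formCoeff η e z = deriv (e' ∘ e.symm) z * formCoeff η e' (e' (e.symm z)) := by
  rw [formCoeff_eq_mul, formCoeff_eq_mul, coordFactor_eq_deriv_mul he he' hz hz', mul_assoc]
  congr 2
  exact congrArg (fun q : C => (η q (1 : ℂ) : ℂ)) (e'.left_inv hz').symm

theorem formCoeff_chartAt [IsManifold 𝓘(ℂ) 1 C] (η : ∀ p : C, TangentSpace 𝓘(ℂ) p →L[ℂ] ℂ)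
    (p : C) : formCoeff η (chartAt ℂ p) (chartAt ℂ p p) = η p (1 : ℂ) := by
  rw [formCoeff_eq_mul, coordFactor_chartAt, one_mul]
  exact congrArg (fun q : C => (η q (1 : ℂ) : ℂ)) ((chartAt ℂ p).left_inv (mem_chart_source ℂ p))

theorem analyticAt_formCoeff (η : holForms C) {e : OpenPartialHomeomorph C ℂ} (he : e ∈ atlas ℂ C)
    {z : ℂ} (hz : z ∈ e.target) : AnalyticAt ℂ (formCoeff η.1 e) z :=
  DifferentiableOn.analyticAt (η.2 e he) (e.open_target.mem_nhds hz)

/-- Holomorphy of a one-form may be tested in the preferred charts. -/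
theorem mem_holForms_of_differentiableAt [IsManifold 𝓘(ℂ) 1 C]
    {η : ∀ p : C, TangentSpace 𝓘(ℂ) p →L[ℂ] ℂ}
    (h : ∀ p, DifferentiableAt ℂ (formCoeff η (chartAt ℂ p)) (chartAt ℂ p p)) :
    η ∈ holForms C := by
  intro e he z hz
  refine DifferentiableAt.differentiableWithinAt ?_
  set e' := chartAt ℂ (e.symm z)
  have he' : e' ∈ atlas ℂ C := chart_mem_atlas _ _
  have hz' : e.symm z ∈ e'.source := mem_chart_source _ _
  have ht := analyticAt_transition he he' hz hz'
  have h1 : DifferentiableAt ℂ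
      (fun w => deriv (e' ∘ e.symm) w * formCoeff η e' ((e' ∘ e.symm) w)) z :=
    ht.deriv.differentiableAt.mul
      (DifferentiableAt.comp (g := formCoeff η e') z (h (e.symm z)) ht.differentiableAt)
  refine h1.congr_of_eventuallyEq ?_
  filter_upwards [eventually_symm_mem hz (e'.open_source.mem_nhds hz')] with w hw
  exact formCoeff_transition η he he' hw.1 hw.2

theorem infinite_of_mem_nhds_surface {p : C} {U : Set C} (hU : U ∈ 𝓝 p) : U.Infinite := by
  set e := chartAt ℂ p
  have hp : e.symm (e p) = p := e.left_inv (mem_chart_source ℂ p)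
  have h1 := eventually_symm_mem (e := e) (mem_chart_target ℂ p) (hp.symm ▸ hU)
  have h2 : {w | w ∈ e.target ∧ e.symm w ∈ U}.Infinite := infinite_of_mem_nhds _ h1
  have h3 := h2.image (f := e.symm) (e.symm.injOn.mono fun w hw => hw.1)
  exact h3.mono (by rintro _ ⟨w, hw, rfl⟩; exact hw.2)

theorem nhdsNE_neBot_surface (p : C) : (𝓝[≠] p).NeBot := by
  rw [← mem_closure_iff_nhdsWithin_neBot, mem_closure_iff_nhds]
  intro U hU
  obtain ⟨q, hq, hqp⟩ := (infinite_of_mem_nhds_surface hU).exists_notMem_finite (finite_singleton p)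
  exact ⟨q, hq, hqp⟩

theorem tendsto_chartAt_nhdsNE (p : C) :
    Tendsto (chartAt ℂ p) (𝓝[≠] p) (𝓝[≠] (chartAt ℂ p p)) := by
  refine tendsto_nhdsWithin_of_tendsto_nhds_of_eventually_within _
    (((chartAt ℂ p).continuousAt (mem_chart_source ℂ p)).mono_left nhdsWithin_le_nhds) ?_
  filter_upwards [self_mem_nhdsWithin, nhdsWithin_le_nhds (chart_source_mem_nhds ℂ p)] with q hq hqs
  intro h
  exact hq ((chartAt ℂ p).injOn hqs (mem_chart_source ℂ p) h)

/-- **Identity theorem** for holomorphic one-forms. -/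
theorem holForm_eq_zero_of_eventually [IsManifold 𝓘(ℂ) 1 C] [ConnectedSpace C] (η : holForms C)
    {p : C} (hp : ∀ᶠ q in 𝓝 p, η.1 q (1 : ℂ) = 0) : η = 0 := by
  let Z : Set C := {p | ∀ᶠ q in 𝓝 p, η.1 q (1 : ℂ) = 0}
  have hcoeff : ∀ p : C, ∀ q ∈ (chartAt ℂ p).source,
      (formCoeff η.1 (chartAt ℂ p) (chartAt ℂ p q) = 0 ↔ η.1 q (1 : ℂ) = 0) := by
    intro p q hq
    rw [formCoeff_eq_mul, mul_eq_zero, or_iff_right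
      (coordFactor_ne_zero (chart_mem_atlas ℂ p) ((chartAt ℂ p).map_source hq))]
    exact Eq.congr_left
      (congrArg (fun q : C => (η.1 q (1 : ℂ) : ℂ)) ((chartAt ℂ p).left_inv hq))
  have hopen : IsOpen Z := isOpen_iff_mem_nhds.2 fun q hq => eventually_eventually_nhds.2 hq
  have hclosed : IsClosed Z := by
    refine isOpen_compl_iff.1 (isOpen_iff_mem_nhds.2 fun q hq => ?_)
    rcases (analyticAt_formCoeff η (chart_mem_atlas ℂ q)
      (mem_chart_target ℂ q)).eventually_eq_zero_or_eventually_ne_zero with h | h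
    · refine absurd ?_ hq
      filter_upwards [((chartAt ℂ q).continuousAt (mem_chart_source ℂ q)).eventually h,
        chart_source_mem_nhds ℂ q] with x hx hxs using (hcoeff q x hxs).1 hx
    · have h1 : ∀ᶠ x in 𝓝[≠] q, η.1 x (1 : ℂ) ≠ 0 := by
        filter_upwards [(tendsto_chartAt_nhdsNE q).eventually h,
          nhdsWithin_le_nhds (chart_source_mem_nhds ℂ q)] with x hx hxs
        exact fun h => hx ((hcoeff q x hxs).2 h)
      rw [eventually_nhdsWithin_iff] at h1
      filter_upwards [h1.eventually_nhds] with x hx hxZ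
      have := nhdsNE_neBot_surface x
      have h2 : ∀ᶠ y in 𝓝 x, y = q := by
        filter_upwards [hx, hxZ] with y hy hy0
        by_contra hne
        exact hy hne hy0
      exact infinite_of_mem_nhds_surface (U := {q}) h2 (finite_singleton q)
  have huniv := IsClopen.eq_univ ⟨hclosed, hopen⟩ ⟨p, hp⟩
  ext q : 2
  have hq : η.1 q (1 : ℂ) = 0 := (huniv ▸ mem_univ q : q ∈ Z).self_of_nhds
  refine ContinuousLinearMap.ext fun v => ?_
  refine (covector_apply_eq_mul (η.1 q) v).trans ?_
  rw [hq]
  exact @mul_zero ℂ _ v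

end Charts

/-! ### Maps to the Riemann sphere with finite fibres -/

section Sphere

theorem coe_sphereCoord {x : OnePoint ℂ} (hx : x ≠ OnePoint.infty) :
    ((sphereCoord x : ℂ) : OnePoint ℂ) = x := by
  induction x using OnePoint.rec with
  | infty => exact absurd rfl hx
  | coe x => rfl

@[simp] theorem sphereCoord_coe (x : ℂ) : sphereCoord (x : OnePoint ℂ) = x := rfl

@[simp] theorem sphereCoord_infty : sphereCoord OnePoint.infty = 0 := rfl

theorem sphereCoord_eq_zero_iff {x : OnePoint ℂ} :
    sphereCoord x = 0 ↔ x = ((0 : ℂ) : OnePoint ℂ) ∨ x = OnePoint.infty := by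
  induction x using OnePoint.rec with
  | infty => simp
  | coe x => simp

variable {C : Type*} [TopologicalSpace C] [ChartedSpace ℂ C] {f : C → OnePoint ℂ}

theorem differentiableAt_comp_symm [IsManifold 𝓘(ℂ) 1 C] {u : C → ℂ} {e : OpenPartialHomeomorph C ℂ}
    (he : e ∈ atlas ℂ C)
    {z : ℂ} (hz : z ∈ e.target) (hu : MDifferentiableAt 𝓘(ℂ) 𝓘(ℂ) u (e.symm z)) :
    DifferentiableAt ℂ (u ∘ e.symm) z :=
  mdifferentiableAt_iff_differentiableAt.1
    (MDifferentiableAt.comp z hu (mdifferentiableAt_atlas_symm (I := 𝓘(ℂ)) he hz))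

theorem IsHolomorphicToSphere.analyticAt_sphereCoord [IsManifold 𝓘(ℂ) 1 C]
    (hf : IsHolomorphicToSphere f)
    {e : OpenPartialHomeomorph C ℂ} (he : e ∈ atlas ℂ C) {z : ℂ} (hz : z ∈ e.target)
    (hfz : f (e.symm z) ≠ OnePoint.infty) :
    AnalyticAt ℂ (fun w => sphereCoord (f (e.symm w))) z := by
  rw [Complex.analyticAt_iff_eventually_differentiableAt]
  filter_upwards [eventually_symm_mem hz
    ((isOpen_ne.preimage hf.continuous).mem_nhds (show f (e.symm z) ≠ OnePoint.infty from hfz))]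
    with w hw
  exact differentiableAt_comp_symm he hw.1 (hf.finite_part _ hw.2)

theorem IsHolomorphicToSphere.analyticAt_sphereCoordInv [IsManifold 𝓘(ℂ) 1 C]
    (hf : IsHolomorphicToSphere f)
    {e : OpenPartialHomeomorph C ℂ} (he : e ∈ atlas ℂ C) {z : ℂ} (hz : z ∈ e.target)
    (hfz : f (e.symm z) ≠ ((0 : ℂ) : OnePoint ℂ)) :
    AnalyticAt ℂ (fun w => sphereCoordInv (f (e.symm w))) z := by
  rw [Complex.analyticAt_iff_eventually_differentiableAt]
  filter_upwards [eventually_symm_mem hz ((isOpen_ne.preimage hf.continuous).mem_nhds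
    (show f (e.symm z) ≠ ((0 : ℂ) : OnePoint ℂ) from hfz))] with w hw
  exact differentiableAt_comp_symm he hw.1 (hf.infinite_part _ hw.2)

theorem not_eventually_eq_of_finite_fibres (hfin : ∀ x, (f ⁻¹' {x}).Finite)
    {e : OpenPartialHomeomorph C ℂ} {z : ℂ} (hz : z ∈ e.target) (x : OnePoint ℂ) :
    ¬ ∀ᶠ w in 𝓝 z, f (e.symm w) = x := by
  intro h
  have h1 : ∀ᶠ q in 𝓝 (e.symm z), f q = x := by
    have hs := e.map_target hz
    have h2 : Tendsto e (𝓝 (e.symm z)) (𝓝 z) := by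
      have := e.continuousAt hs
      rwa [ContinuousAt, e.right_inv hz] at this
    filter_upwards [h2.eventually h, e.open_source.mem_nhds hs] with q hq hqs
    rwa [e.left_inv hqs] at hq
  exact infinite_of_mem_nhds_surface h1 (hfin x)

theorem IsHolomorphicToSphere.not_eventually_sphereCoord_eq (hf : IsHolomorphicToSphere f)
    (hfin : ∀ x, (f ⁻¹' {x}).Finite) {e : OpenPartialHomeomorph C ℂ} {z : ℂ} (hz : z ∈ e.target)
    (hfz : f (e.symm z) ≠ OnePoint.infty) (a : ℂ) :
    ¬ ∀ᶠ w in 𝓝 z, sphereCoord (f (e.symm w)) = a := by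
  intro h
  refine not_eventually_eq_of_finite_fibres hfin hz (a : OnePoint ℂ) ?_
  filter_upwards [h, eventually_symm_mem hz ((isOpen_ne.preimage hf.continuous).mem_nhds
    (show f (e.symm z) ≠ OnePoint.infty from hfz))] with w hw hw'
  rw [← coe_sphereCoord hw'.2, hw]

theorem IsHolomorphicToSphere.not_eventually_sphereCoordInv_eq (hf : IsHolomorphicToSphere f)
    (hfin : ∀ x, (f ⁻¹' {x}).Finite) {e : OpenPartialHomeomorph C ℂ} {z : ℂ} (hz : z ∈ e.target)
    (hfz : f (e.symm z) = OnePoint.infty) :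
    ¬ ∀ᶠ w in 𝓝 z, sphereCoordInv (f (e.symm w)) = 0 := by
  intro h
  refine not_eventually_eq_of_finite_fibres hfin hz OnePoint.infty ?_
  filter_upwards [h, eventually_symm_mem hz ((isOpen_ne.preimage hf.continuous).mem_nhds
    (show f (e.symm z) ≠ ((0 : ℂ) : OnePoint ℂ) by rw [hfz]; exact OnePoint.infty_ne_coe _))]
    with w hw hw'
  rcases sphereCoord_eq_zero_iff.1 (inv_eq_zero.1 hw) with h0 | h0
  · exact absurd h0 hw'.2
  · exact h0

/-! ### The quotient of a one-form by the differential of the map -/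

/-- The derivative of the meromorphic function `f` in the preferred chart at `p`. -/
noncomputable def derivAt (f : C → OnePoint ℂ) (p : C) : ℂ :=
  deriv (fun w => sphereCoord (f ((chartAt ℂ p).symm w))) (chartAt ℂ p p)

/-- The meromorphic function `η / df`. It has the value zero at the finite critical points of `f`,
and its values at the poles of `f`, where `derivAt` is not meaningful, are never used. -/
noncomputable def quotDeriv (η : holForms C) (f : C → OnePoint ℂ) (p : C) : ℂ :=
  formCoeff η.1 (chartAt ℂ p) (chartAt ℂ p p) / derivAt f p

theorem IsHolomorphicToSphere.deriv_eq [IsManifold 𝓘(ℂ) 1 C] (hf : IsHolomorphicToSphere f)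
    {e : OpenPartialHomeomorph C ℂ} (he : e ∈ atlas ℂ C) {z : ℂ} (hz : z ∈ e.target)
    (hfz : f (e.symm z) ≠ OnePoint.infty) :
    deriv (fun w => sphereCoord (f (e.symm w))) z =
      deriv (chartAt ℂ (e.symm z) ∘ e.symm) z * derivAt f (e.symm z) := by
  set e' := chartAt ℂ (e.symm z) with he'def
  have he' : e' ∈ atlas ℂ C := chart_mem_atlas _ _
  have hz' : e.symm z ∈ e'.source := mem_chart_source _ _
  have h1 := (analyticAt_transition he he' hz hz').differentiableAt.hasDerivAt
  have h2 := (hf.analyticAt_sphereCoord he' (e'.map_source hz')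
    (by rwa [e'.left_inv hz'])).differentiableAt.hasDerivAt
  have h3 := HasDerivAt.comp z h2 h1
  have h4 : HasDerivAt (fun w => sphereCoord (f (e.symm w)))
      (derivAt f (e.symm z) * deriv (e' ∘ e.symm) z) z := by
    refine h3.congr_of_eventuallyEq ?_
    filter_upwards [eventually_symm_mem hz (e'.open_source.mem_nhds hz')] with w hw
    simp [e'.left_inv hw.2]
  rw [h4.deriv, mul_comm]

theorem IsHolomorphicToSphere.quotDeriv_symm [IsManifold 𝓘(ℂ) 1 C] (hf : IsHolomorphicToSphere f)
    (η : holForms C)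
    {e : OpenPartialHomeomorph C ℂ} (he : e ∈ atlas ℂ C) {z : ℂ} (hz : z ∈ e.target)
    (hfz : f (e.symm z) ≠ OnePoint.infty) :
    quotDeriv η f (e.symm z) =
      formCoeff η.1 e z / deriv (fun w => sphereCoord (f (e.symm w))) z := by
  have hz' := mem_chart_source ℂ (e.symm z)
  have he' := chart_mem_atlas ℂ (e.symm z)
  rw [hf.deriv_eq he hz hfz, formCoeff_transition η.1 he he' hz hz',
    mul_div_mul_left _ _ (deriv_transition_ne_zero he he' hz hz'), quotDeriv]

theorem IsHolomorphicToSphere.derivAt_ne_zero_iff [IsManifold 𝓘(ℂ) 1 C]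
    (hf : IsHolomorphicToSphere f)
    {e : OpenPartialHomeomorph C ℂ} (he : e ∈ atlas ℂ C) {z : ℂ} (hz : z ∈ e.target)
    (hfz : f (e.symm z) ≠ OnePoint.infty) :
    derivAt f (e.symm z) ≠ 0 ↔ deriv (fun w => sphereCoord (f (e.symm w))) z ≠ 0 := by
  rw [hf.deriv_eq he hz hfz, mul_ne_zero_iff, and_iff_right (deriv_transition_ne_zero he
    (chart_mem_atlas ℂ (e.symm z)) hz (mem_chart_source ℂ (e.symm z)))]

/-- Near a pole, `f = 1 / Φ` in a chart, so `f' = - Φ' / Φ²`. -/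
theorem IsHolomorphicToSphere.deriv_eq_neg_div [IsManifold 𝓘(ℂ) 1 C] (hf : IsHolomorphicToSphere f)
    {e : OpenPartialHomeomorph C ℂ} (he : e ∈ atlas ℂ C) {z : ℂ} (hz : z ∈ e.target)
    (hfz : f (e.symm z) ≠ OnePoint.infty) (hfz' : f (e.symm z) ≠ ((0 : ℂ) : OnePoint ℂ)) :
    deriv (fun w => sphereCoord (f (e.symm w))) z =
      - deriv (fun w => sphereCoordInv (f (e.symm w))) z /
        sphereCoordInv (f (e.symm z)) ^ 2 := by
  have h1 := (hf.analyticAt_sphereCoordInv he hz hfz').differentiableAt.hasDerivAt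
  have hne : sphereCoordInv (f (e.symm z)) ≠ 0 := by
    refine inv_ne_zero fun h => ?_
    rcases sphereCoord_eq_zero_iff.1 h with h | h
    exacts [hfz' h, hfz h]
  have h2 := h1.fun_inv hne
  simp only [sphereCoordInv, inv_inv] at h2 ⊢
  exact h2.deriv

/-- The local behaviour of `f` and of `η / df` at a finite point. -/
theorem IsHolomorphicToSphere.local_finite [IsManifold 𝓘(ℂ) 1 C] (hf : IsHolomorphicToSphere f)
    (hfin : ∀ x, (f ⁻¹' {x}).Finite) (η : holForms C) {p : C} (hp : f p ≠ OnePoint.infty) :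
    (∀ᶠ q in 𝓝[≠] p, derivAt f q ≠ 0) ∧
      Tendsto (fun q => (sphereCoord (f q) - sphereCoord (f p)) * quotDeriv η f q) (𝓝 p) (𝓝 0) := by
  set e := chartAt ℂ p
  have he : e ∈ atlas ℂ C := chart_mem_atlas ℂ p
  have hz : e p ∈ e.target := mem_chart_target ℂ p
  have hps : e.symm (e p) = p := e.left_inv (mem_chart_source ℂ p)
  have hfz : f (e.symm (e p)) ≠ OnePoint.infty := by rwa [hps]
  obtain ⟨h1, h2⟩ := deriv_ne_zero_and_tendsto_sub_div_deriv (hf.analyticAt_sphereCoord he hz hfz)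
    (hf.not_eventually_sphereCoord_eq hfin hz hfz _)
  have hnear : ∀ᶠ q in 𝓝 p, q ∈ e.source ∧ f q ≠ OnePoint.infty :=
    (e.open_source.eventually_mem (mem_chart_source ℂ p)).and
      ((isOpen_ne.preimage hf.continuous).mem_nhds hp)
  refine ⟨?_, ?_⟩
  · filter_upwards [(tendsto_chartAt_nhdsNE p).eventually h1, nhdsWithin_le_nhds hnear]
      with q hq hqn
    have h3 := hf.derivAt_ne_zero_iff he (e.map_source hqn.1)
        (by rw [e.left_inv hqn.1]; exact hqn.2)
    rw [e.left_inv hqn.1] at h3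
    exact h3.2 hq
  · have h3 := h2.mul (analyticAt_formCoeff η he hz).continuousAt.tendsto
    rw [zero_mul] at h3
    refine (h3.comp (e.continuousAt (mem_chart_source ℂ p))).congr' ?_
    filter_upwards [hnear] with q hq
    have h4 := hf.quotDeriv_symm η he (e.map_source hq.1) (by rw [e.left_inv hq.1]; exact hq.2)
    rw [e.left_inv hq.1] at h4
    rw [h4]
    simp only [Function.comp_apply, hps, e.left_inv hq.1]
    ring

/-- The local behaviour of `f` and of `η / df` at a pole. -/
theorem IsHolomorphicToSphere.local_infinite [IsManifold 𝓘(ℂ) 1 C] [T2Space C]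
    (hf : IsHolomorphicToSphere f)
    (hfin : ∀ x, (f ⁻¹' {x}).Finite) (η : holForms C) {p : C} (hp : f p = OnePoint.infty) :
    (∀ᶠ q in 𝓝[≠] p, f q ≠ OnePoint.infty ∧ derivAt f q ≠ 0) ∧
      Tendsto (quotDeriv η f) (𝓝[≠] p) (𝓝 0) := by
  set e := chartAt ℂ p
  have he : e ∈ atlas ℂ C := chart_mem_atlas ℂ p
  have hz : e p ∈ e.target := mem_chart_target ℂ p
  have hps : e.symm (e p) = p := e.left_inv (mem_chart_source ℂ p)
  have hp0 : f p ≠ ((0 : ℂ) : OnePoint ℂ) := by rw [hp]; exact OnePoint.infty_ne_coe _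
  have hfz : f (e.symm (e p)) ≠ ((0 : ℂ) : OnePoint ℂ) := by rwa [hps]
  set Φ : ℂ → ℂ := fun w => sphereCoordInv (f (e.symm w)) with hΦ
  have hΦa : AnalyticAt ℂ Φ (e p) := hf.analyticAt_sphereCoordInv he hz hfz
  have hΦ0 : Φ (e p) = 0 := by simp [hΦ, hps, hp, sphereCoordInv]
  obtain ⟨h1, h2⟩ := deriv_ne_zero_and_tendsto_sub_div_deriv hΦa (by
    rw [hΦ0]; exact hf.not_eventually_sphereCoordInv_eq hfin hz (by rwa [hps]))
  have hnear : ∀ᶠ q in 𝓝 p, q ∈ e.source ∧ f q ≠ ((0 : ℂ) : OnePoint ℂ) :=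
    (e.open_source.eventually_mem (mem_chart_source ℂ p)).and
      ((isOpen_ne.preimage hf.continuous).mem_nhds hp0)
  have hinf : ∀ᶠ q in 𝓝[≠] p, f q ≠ OnePoint.infty := by
    have h3 : ∀ᶠ q in 𝓝 p, q ∉ f ⁻¹' {OnePoint.infty} \ {p} := by
      exact ((hfin OnePoint.infty).subset sdiff_subset).isClosed.isOpen_compl.mem_nhds (by simp)
    filter_upwards [nhdsWithin_le_nhds h3, self_mem_nhdsWithin] with q hq hqp h
    exact hq ⟨h, hqp⟩
  refine ⟨?_, ?_⟩
  · filter_upwards [(tendsto_chartAt_nhdsNE p).eventually h1, nhdsWithin_le_nhds hnear, hinf]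
      with q hq hqn hqi
    refine ⟨hqi, ?_⟩
    have hi : f (e.symm (e q)) ≠ OnePoint.infty := by rwa [e.left_inv hqn.1]
    have h0 : f (e.symm (e q)) ≠ ((0 : ℂ) : OnePoint ℂ) := by rw [e.left_inv hqn.1]; exact hqn.2
    have h3 := hf.derivAt_ne_zero_iff he (e.map_source hqn.1) hi
    rw [e.left_inv hqn.1] at h3
    refine h3.2 ?_
    rw [hf.deriv_eq_neg_div he (e.map_source hqn.1) hi h0]
    refine div_ne_zero (neg_ne_zero.2 hq) (pow_ne_zero _ (inv_ne_zero fun h => ?_))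
    rcases sphereCoord_eq_zero_iff.1 h with h | h
    exacts [h0 h, hi h]
  · have h3 : Tendsto (fun z => -((Φ z - Φ (e p)) / deriv Φ z * Φ z * formCoeff η.1 e z)) (𝓝 (e p))
        (𝓝 (-(0 * Φ (e p) * formCoeff η.1 e (e p)))) :=
      ((h2.mul hΦa.continuousAt.tendsto).mul
        (analyticAt_formCoeff η he hz).continuousAt.tendsto).neg
    rw [zero_mul, zero_mul, neg_zero] at h3
    refine ((h3.comp (e.continuousAt (mem_chart_source ℂ p))).mono_left
      nhdsWithin_le_nhds).congr' ?_
    filter_upwards [nhdsWithin_le_nhds hnear, hinf] with q hqn hqi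
    have hi : f (e.symm (e q)) ≠ OnePoint.infty := by rwa [e.left_inv hqn.1]
    have h0 : f (e.symm (e q)) ≠ ((0 : ℂ) : OnePoint ℂ) := by rw [e.left_inv hqn.1]; exact hqn.2
    have h4 := hf.quotDeriv_symm η he (e.map_source hqn.1) hi
    rw [hf.deriv_eq_neg_div he (e.map_source hqn.1) hi h0, e.left_inv hqn.1] at h4
    rw [h4]
    simp only [Function.comp_apply, hΦ0, sub_zero]
    simp only [hΦ, e.left_inv hqn.1, div_neg, div_div_eq_mul_div]
    ring

end Sphere

theorem exists_local_inverse {G : ℂ → ℂ} {z₀ : ℂ} (hG : AnalyticAt ℂ G z₀) (hd : deriv G z₀ ≠ 0) :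
    ∃ s : ℂ → ℂ, AnalyticAt ℂ s (G z₀) ∧ s (G z₀) = z₀ ∧ (∀ᶠ z in 𝓝 z₀, s (G z) = z) ∧
      ∀ᶠ x in 𝓝 (G z₀), G (s x) = x :=
  ⟨_, hG.analyticAt_localInverse hd, HasStrictFDerivAt.localInverse_apply_image ..,
    HasStrictDerivAt.eventually_left_inverse .., HasStrictDerivAt.eventually_right_inverse ..⟩

/-! ### The trace of a function along the fibres -/

section Trace

variable {C : Type*}

/-- The sum of the values of a function over a finite fibre of `f`. -/
noncomputable def fibreTrace (f : C → OnePoint ℂ) (m : C → ℂ) (x : ℂ) : ℂ :=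
  ∑ᶠ p ∈ f ⁻¹' {(x : OnePoint ℂ)}, m p

theorem norm_fibreTrace_le {f : C → OnePoint ℂ} (hcard : ∀ x, (f ⁻¹' {x}).encard ≤ 2) {m : C → ℂ}
    {x : ℂ} {ε : ℝ} (hε : 0 ≤ ε) (h : ∀ p, f p = (x : OnePoint ℂ) → ‖m p‖ ≤ ε) :
    ‖fibreTrace f m x‖ ≤ 2 * ε := by
  have hfin : (f ⁻¹' {(x : OnePoint ℂ)}).Finite :=
    finite_of_encard_le_coe (k := 2) (by simpa using hcard x)
  rw [fibreTrace, finsum_mem_eq_finite_toFinset_sum _ hfin]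
  refine (norm_sum_le_of_le _ (fun p hp => h p (by simpa using hp))).trans ?_
  rw [Finset.sum_const, nsmul_eq_mul]
  have h1 : hfin.toFinset.card ≤ 2 := by
    have := hcard (x : OnePoint ℂ)
    rw [hfin.encard_eq_coe_toFinset_card] at this
    exact_mod_cast this
  exact mul_le_mul_of_nonneg_right (by exact_mod_cast h1) hε

variable [TopologicalSpace C]

/-- A property that holds near a fibre holds on the nearby fibres, since `f` is closed. -/
theorem eventually_fibre [CompactSpace C] {f : C → OnePoint ℂ} (hf : Continuous f) {y : OnePoint ℂ}
    {P : C → Prop} (h : ∀ p, f p = y → ∀ᶠ q in 𝓝 p, P q) :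
    ∀ᶠ x in 𝓝 y, ∀ q, f q = x → P q := by
  have := hf.isClosedMap.eventually_nhds_fiber y (p := P) (fun p hp => h p hp)
  exact this

variable [ChartedSpace ℂ C] [IsManifold 𝓘(ℂ) 1 C] {f : C → OnePoint ℂ}

/-- Around a finite point which is not critical, `f` has a section along which `η / df` is
holomorphic. -/
theorem IsHolomorphicToSphere.exists_section (hf : IsHolomorphicToSphere f) (η : holForms C) {p : C}
    {x₀ : ℂ} (hp : f p = (x₀ : OnePoint ℂ)) (hd : derivAt f p ≠ 0) :
    ∃ (s : ℂ → C) (U : Set C), U ∈ 𝓝 p ∧ ContinuousAt s x₀ ∧ s x₀ = p ∧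
      (∀ᶠ x in 𝓝 x₀, f (s x) = (x : OnePoint ℂ)) ∧ (∀ q ∈ U, ∀ x : ℂ, f q = x → q = s x) ∧
      DifferentiableAt ℂ (fun x => quotDeriv η f (s x)) x₀ := by
  set e := chartAt ℂ p
  have he : e ∈ atlas ℂ C := chart_mem_atlas ℂ p
  have hz : e p ∈ e.target := mem_chart_target ℂ p
  have hps : e.symm (e p) = p := e.left_inv (mem_chart_source ℂ p)
  have hpi : f p ≠ OnePoint.infty := by rw [hp]; exact OnePoint.coe_ne_infty _
  have hfz : f (e.symm (e p)) ≠ OnePoint.infty := by rwa [hps]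
  have hGa := hf.analyticAt_sphereCoord he hz hfz
  have hGd := (hf.derivAt_ne_zero_iff he hz hfz).1 (by rwa [hps])
  set G : ℂ → ℂ := fun w => sphereCoord (f (e.symm w)) with hG
  have hG0 : G (e p) = x₀ := by simp [hG, hps, hp]
  obtain ⟨s, hsa, hs0, hsl, hsr⟩ := exists_local_inverse hGa hGd
  rw [hG0] at hsa hs0 hsr
  have hnear : ∀ᶠ w in 𝓝 (e p), w ∈ e.target ∧ f (e.symm w) ≠ OnePoint.infty :=
    eventually_symm_mem hz ((isOpen_ne.preimage hf.continuous).mem_nhds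
      (show f (e.symm (e p)) ≠ OnePoint.infty from hfz))
  have hsnear : ∀ᶠ x in 𝓝 x₀, s x ∈ e.target ∧ f (e.symm (s x)) ≠ OnePoint.infty := by
    have := hsa.continuousAt.tendsto
    rw [hs0] at this
    exact this.eventually hnear
  refine ⟨fun x => e.symm (s x), {q | q ∈ e.source ∧ s (G (e q)) = e q}, ?_, ?_, ?_, ?_, ?_, ?_⟩
  · exact (e.open_source.eventually_mem (mem_chart_source ℂ p)).and
      ((e.continuousAt (mem_chart_source ℂ p)).eventually hsl)
  · refine ContinuousAt.comp (g := e.symm) (f := s) ?_ hsa.continuousAt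
    rw [hs0]
    exact e.symm.continuousAt hz
  · simp only [hs0, hps]
  · filter_upwards [hsr, hsnear] with x hx hx'
    rw [← coe_sphereCoord hx'.2]
    exact congrArg _ hx
  · rintro q ⟨hq, hq'⟩ x hx
    simp only [hG, e.left_inv hq, hx, sphereCoord_coe] at hq'
    exact (e.left_inv hq).symm.trans (congrArg e.symm hq'.symm)
  · have h1 : DifferentiableAt ℂ (fun x => formCoeff η.1 e (s x) / deriv G (s x)) x₀ := by
      refine DifferentiableAt.div ?_ ?_ (by rwa [hs0])
      · refine DifferentiableAt.comp (g := formCoeff η.1 e) x₀ ?_ hsa.differentiableAt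
        rw [hs0]
        exact (analyticAt_formCoeff η he hz).differentiableAt
      · refine DifferentiableAt.comp (g := deriv G) x₀ ?_ hsa.differentiableAt
        rw [hs0]
        exact hGa.deriv.differentiableAt
    refine h1.congr_of_eventuallyEq ?_
    filter_upwards [hsnear] with x hx
    exact hf.quotDeriv_symm η he hx.1 hx.2

/-- The trace of `η / df` is holomorphic at the finite values that are not critical. -/
theorem IsHolomorphicToSphere.differentiableAt_fibreTrace [CompactSpace C] [T2Space C]
    (hf : IsHolomorphicToSphere f) (hfin : ∀ x, (f ⁻¹' {x}).Finite) (η : holForms C) {x₀ : ℂ}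
    (hd : ∀ p, f p = (x₀ : OnePoint ℂ) → derivAt f p ≠ 0) :
    DifferentiableAt ℂ (fibreTrace f (quotDeriv η f)) x₀ := by
  classical
  set S := f ⁻¹' {(x₀ : OnePoint ℂ)} with hS
  have hex : ∀ p : C, ∃ (s : ℂ → C) (U : Set C), p ∈ S → U ∈ 𝓝 p ∧ ContinuousAt s x₀ ∧ s x₀ = p ∧
      (∀ᶠ x in 𝓝 x₀, f (s x) = (x : OnePoint ℂ)) ∧ (∀ q ∈ U, ∀ x : ℂ, f q = x → q = s x) ∧
      DifferentiableAt ℂ (fun x => quotDeriv η f (s x)) x₀ := by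
    intro p
    by_cases hp : p ∈ S
    · obtain ⟨s, U, h⟩ := hf.exists_section η hp (hd p hp)
      exact ⟨s, U, fun _ => h⟩
    · exact ⟨fun _ => p, univ, fun h => absurd h hp⟩
  choose s U hsU using hex
  have hSfin : S.Finite := hfin _
  obtain ⟨W, hW, hWd⟩ := hSfin.t2_separation
  have h1 : ∀ᶠ x : ℂ in 𝓝 x₀, ∀ q, f q = (x : OnePoint ℂ) → ∃ p ∈ S, q ∈ U p := by
    have := eventually_fibre (f := f) (y := (x₀ : OnePoint ℂ)) (P := fun q => ∃ p ∈ S, q ∈ U p)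
      hf.continuous fun p hp => by
        filter_upwards [(hsU p hp).1] with q hq using ⟨p, hp, hq⟩
    exact OnePoint.continuous_coe.continuousAt.eventually this
  have h2 : ∀ᶠ x in 𝓝 x₀, ∀ p ∈ S, f (s p x) = (x : OnePoint ℂ) ∧ s p x ∈ W p := by
    rw [eventually_all_finite hSfin]
    intro p hp
    obtain ⟨-, hc, h0, hev, -⟩ := hsU p hp
    refine hev.and (hc.eventually ?_)
    rw [h0]
    exact (hW p).2.mem_nhds (hW p).1
  have h3 : ∀ᶠ x in 𝓝 x₀, fibreTrace f (quotDeriv η f) x =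
      ∑ p ∈ hSfin.toFinset, quotDeriv η f (s p x) := by
    filter_upwards [h1, h2] with x hx1 hx2
    have hinj : Set.InjOn (fun p => s p x) S := by
      intro p hp q hq hpq
      by_contra hne
      have hpq' : s p x = s q x := hpq
      exact Set.disjoint_left.1 (hWd hp hq hne) (hx2 p hp).2 (hpq' ▸ (hx2 q hq).2)
    have himage : f ⁻¹' {(x : OnePoint ℂ)} = (fun p => s p x) '' S := by
      ext q
      constructor
      · intro hq
        obtain ⟨p, hp, hqp⟩ := hx1 q hq
        exact ⟨p, hp, ((hsU p hp).2.2.2.2.1 q hqp x hq).symm⟩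
      · rintro ⟨p, hp, rfl⟩
        exact (hx2 p hp).1
    rw [fibreTrace, himage, finsum_mem_image hinj, finsum_mem_eq_finite_toFinset_sum _ hSfin]
  refine DifferentiableAt.congr_of_eventuallyEq ?_ h3
  refine DifferentiableAt.fun_sum fun p hp => ?_
  exact (hsU p (by simpa using hp)).2.2.2.2.2

/-- The points with vanishing derivative form a finite set. -/
theorem IsHolomorphicToSphere.finite_critical [CompactSpace C] [T2Space C]
    (hf : IsHolomorphicToSphere f) (hfin : ∀ x, (f ⁻¹' {x}).Finite) :
    {p | derivAt f p = 0}.Finite := by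
  have h : ∀ p : C, ∃ U ∈ 𝓝 p, U ∩ {p | derivAt f p = 0} ⊆ {p} := by
    intro p
    have h1 : ∀ᶠ q in 𝓝[≠] p, derivAt f q ≠ 0 := by
      by_cases hp : f p = OnePoint.infty
      · exact (hf.local_infinite hfin (0 : holForms C) hp).1.mono fun q hq => hq.2
      · exact (hf.local_finite hfin (0 : holForms C) hp).1
    rw [eventually_nhdsWithin_iff] at h1
    refine ⟨_, h1, ?_⟩
    rintro q ⟨hq, hq'⟩
    by_contra hne
    exact hq hne hq'
  choose U hU hUs using h
  obtain ⟨t, -, ht⟩ := isCompact_univ.elim_nhds_subcover U fun p _ => hU p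
  refine t.finite_toSet.subset fun q hq => ?_
  obtain ⟨p, hp, hqp⟩ := mem_iUnion₂.1 (ht (mem_univ q))
  have : q = p := hUs p ⟨hqp, hq⟩
  rwa [this]

/-- **Vanishing of the trace**: the sum of `η / df` over the fibres of `f` is zero off a finite
set, since the sphere carries no holomorphic one-form. -/
theorem IsHolomorphicToSphere.exists_fibreTrace_eq_zero [CompactSpace C] [T2Space C]
    (hf : IsHolomorphicToSphere f) (hcard : ∀ x, (f ⁻¹' {x}).encard ≤ 2) (η : holForms C) :
    ∃ B : Finset ℂ, ∀ x ∉ B, fibreTrace f (quotDeriv η f) x = 0 := by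
  classical
  have hfin : ∀ x, (f ⁻¹' {x}).Finite := fun x =>
    finite_of_encard_le_coe (k := 2) (by simpa using hcard x)
  refine ⟨((hf.finite_critical hfin).image fun p => sphereCoord (f p)).toFinset, ?_⟩
  refine eq_zero_of_differentiableOn_compl_finset _ ?_ ?_ ?_
  · intro x hx
    refine (hf.differentiableAt_fibreTrace hfin η fun p hp h => hx ?_).differentiableWithinAt
    simp only [Finite.coe_toFinset]
    exact ⟨p, h, by simp [hp]⟩
  · intro a _
    rw [Metric.tendsto_nhds]
    intro ε hε
    have h1 := eventually_fibre (f := f) (y := (a : OnePoint ℂ))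
      (P := fun q => ‖(sphereCoord (f q) - a) * quotDeriv η f q‖ < ε / 3) hf.continuous (by
        intro p hp
        have h2 := (hf.local_finite hfin η (p := p) (by rw [hp]; exact OnePoint.coe_ne_infty _)).2
        rw [hp, sphereCoord_coe] at h2
        have h3 := (Metric.tendsto_nhds.1 h2) (ε / 3) (by positivity)
        simpa using h3)
    have h4 := OnePoint.continuous_coe.continuousAt.eventually h1
    filter_upwards [nhdsWithin_le_nhds h4] with x hx
    have h5 : (x - a) * fibreTrace f (quotDeriv η f) x =
        fibreTrace f (fun q => (x - a) * quotDeriv η f q) x := by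
      rw [fibreTrace, fibreTrace, mul_finsum_mem]
    rw [dist_zero_right, h5]
    refine (norm_fibreTrace_le hcard (ε := ε / 3) (by positivity) fun p hp => ?_).trans_lt
      (by linarith)
    have := hx p hp
    rw [hp, sphereCoord_coe] at this
    exact this.le
  · rw [Metric.tendsto_nhds]
    intro ε hε
    have h1 := eventually_fibre (f := f) (y := OnePoint.infty)
      (P := fun q => f q ≠ OnePoint.infty → ‖quotDeriv η f q‖ < ε / 3) hf.continuous (by
        intro p hp
        have h2 := (hf.local_infinite hfin η hp).2
        have h3 := (Metric.tendsto_nhds.1 h2) (ε / 3) (by positivity)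
        rw [eventually_nhdsWithin_iff] at h3
        filter_upwards [h3] with q hq hqi
        have := hq (fun h => hqi (by rw [mem_singleton_iff.1 h, hp]))
        simpa using this)
    have h4 := (OnePoint.tendsto_coe_infty (X := ℂ)).eventually h1
    rw [coclosedCompact_eq_cocompact] at h4
    filter_upwards [h4] with x hx
    rw [dist_zero_right]
    refine (norm_fibreTrace_le hcard (ε := ε / 3) (by positivity) fun p hp => ?_).trans_lt
      (by linarith)
    exact (hx p hp (by rw [hp]; exact OnePoint.coe_ne_infty _)).le

end Trace

/-! ### A holomorphic one-form with a double zero at the pole -/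

/-- An even holomorphic function which vanishes at the origin does so to the second order. -/
theorem exists_eventually_eq_sq_mul_of_even {H : ℂ → ℂ} (hH : AnalyticAt ℂ H 0) (h0 : H 0 = 0)
    (heven : ∀ᶠ t in 𝓝 0, H (-t) = H t) :
    ∃ K : ℂ → ℂ, AnalyticAt ℂ K 0 ∧ ∀ t, H t = t ^ 2 * K t := by
  have hd : deriv H 0 = 0 := by
    have h1 : (fun t => H (-t)) =ᶠ[𝓝 0] H := heven
    have h2 := h1.deriv_eq
    rw [deriv_comp_neg, neg_zero] at h2
    linear_combination (-1 / 2 : ℂ) * h2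
  have hslope : ∀ {u : ℂ → ℂ}, AnalyticAt ℂ u 0 → AnalyticAt ℂ (dslope u 0) 0 := by
    rintro u ⟨p, hp⟩
    exact ⟨_, hp.has_fpower_series_dslope_fslope⟩
  have hmul : ∀ {u : ℂ → ℂ}, u 0 = 0 → ∀ t, u t = t * dslope u 0 t := by
    intro u hu t
    have := sub_smul_dslope u 0 t
    rw [hu, sub_zero, sub_zero, smul_eq_mul] at this
    exact this.symm
  refine ⟨dslope (dslope H 0) 0, hslope (hslope hH), fun t => ?_⟩
  have h1 : dslope H 0 0 = 0 := by rw [dslope_same, hd]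
  rw [hmul h0 t, hmul h1 t]
  ring

theorem tendsto_inv_pow_cocompact (k : ℕ) :
    Tendsto (fun t : ℂ => (t ^ (k + 1))⁻¹) (𝓝[≠] 0) (cocompact ℂ) := by
  rw [← Metric.cobounded_eq_cocompact]
  refine tendsto_inv₀_nhdsNE_zero.comp ?_
  refine tendsto_nhdsWithin_of_tendsto_nhds_of_eventually_within _ ?_ ?_
  · have : Tendsto (fun t : ℂ => t ^ (k + 1)) (𝓝 0) (𝓝 (0 ^ (k + 1))) :=
      (continuous_pow (k + 1)).tendsto 0
    rw [zero_pow k.succ_ne_zero] at this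
    exact this.mono_left nhdsWithin_le_nhds
  · filter_upwards [self_mem_nhdsWithin] with t ht using pow_ne_zero _ ht

theorem tendsto_mul_left_nhdsNE_zero {c : ℂ} (hc : c ≠ 0) :
    Tendsto (fun t : ℂ => c * t) (𝓝[≠] 0) (𝓝[≠] 0) := by
  refine tendsto_nhdsWithin_of_tendsto_nhds_of_eventually_within _ ?_ ?_
  · have : Tendsto (fun t : ℂ => c * t) (𝓝 0) (𝓝 (c * 0)) := (continuous_const_mul c).tendsto 0
    rw [mul_zero] at this
    exact this.mono_left nhdsWithin_le_nhds
  · filter_upwards [self_mem_nhdsWithin] with t ht using mul_ne_zero hc ht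

section Pole

variable {C : Type*} [TopologicalSpace C] [ChartedSpace ℂ C] {f : C → OnePoint ℂ}

/-- A local parametrization `t ↦ (chartAt ℂ w).symm (s t)` of the curve near the
only pole `w` of `f`, in which `f` is `1 / t ^ (k + 1)`. -/
structure PoleParam (f : C → OnePoint ℂ) (w : C) where
  /-- one less than the order of the pole -/
  k : ℕ
  /-- the parameter as a function in the preferred chart -/
  ψ : ℂ → ℂ
  /-- the inverse of `ψ` -/
  s : ℂ → ℂ
  analyticAt_ψ : AnalyticAt ℂ ψ (chartAt ℂ w w)
  ψ_pole : ψ (chartAt ℂ w w) = 0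
  analyticAt_s : AnalyticAt ℂ s 0
  s_zero : s 0 = chartAt ℂ w w
  s_ψ : ∀ᶠ z in 𝓝 (chartAt ℂ w w), s (ψ z) = z
  ψ_s : ∀ᶠ t in 𝓝 0, ψ (s t) = t
  s_mem : ∀ᶠ t in 𝓝 0, s t ∈ (chartAt ℂ w).target
  inv_eq : ∀ᶠ z in 𝓝 (chartAt ℂ w w), sphereCoordInv (f ((chartAt ℂ w).symm z)) = ψ z ^ (k + 1)
  apply_eq : ∀ᶠ t in 𝓝[≠] (0 : ℂ), f ((chartAt ℂ w).symm (s t)) =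
      (((t ^ (k + 1))⁻¹ : ℂ) : OnePoint ℂ)
  fibre : ∀ᶠ t in 𝓝[≠] (0 : ℂ), ∀ q, f q = (((t ^ (k + 1))⁻¹ : ℂ) : OnePoint ℂ) →
    ∃ t', q = (chartAt ℂ w).symm (s t') ∧ t' ^ (k + 1) = t ^ (k + 1)

/-- The only pole `w` of `f` has such a parametrization: a root of `1 / f` is a parameter. -/
theorem IsHolomorphicToSphere.exists_poleParam [IsManifold 𝓘(ℂ) 1 C] [CompactSpace C] [T2Space C]
    (hf : IsHolomorphicToSphere f) (hfin : ∀ x, (f ⁻¹' {x}).Finite) {w : C}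
    (hw : f ⁻¹' {OnePoint.infty} = {w}) : Nonempty (PoleParam f w) := by
  set e := chartAt ℂ w with hedef
  have he : e ∈ atlas ℂ C := chart_mem_atlas ℂ w
  have hz : e w ∈ e.target := mem_chart_target ℂ w
  have hws : e.symm (e w) = w := e.left_inv (mem_chart_source ℂ w)
  have hwi : f w = OnePoint.infty := by
    have : w ∈ f ⁻¹' {OnePoint.infty} := by rw [hw]; rfl
    exact this
  have hfz : f (e.symm (e w)) ≠ ((0 : ℂ) : OnePoint ℂ) := by
    rw [hws, hwi]; exact OnePoint.infty_ne_coe _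
  set Φ : ℂ → ℂ := fun z => sphereCoordInv (f (e.symm z)) with hΦ
  have hΦa : AnalyticAt ℂ Φ (e w) := hf.analyticAt_sphereCoordInv he hz hfz
  have hΦ0 : Φ (e w) = 0 := by simp [hΦ, hws, hwi, sphereCoordInv]
  obtain ⟨k, ψ, hψa, hψ0, hψd, hψ⟩ := exists_eventually_eq_pow hΦa hΦ0
    (hf.not_eventually_sphereCoordInv_eq hfin hz (by rwa [hws]))
  obtain ⟨s, hsa, hs0, hsl, hsr⟩ := exists_local_inverse hψa hψd
  rw [hψ0] at hsa hs0 hsr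
  have hst : Tendsto s (𝓝 0) (𝓝 (e w)) := by
    have := hsa.continuousAt.tendsto
    rwa [hs0] at this
  refine ⟨⟨k, ψ, s, hψa, hψ0, hsa, hs0, hsl, hsr, hst.eventually (e.open_target.mem_nhds hz), hψ,
    ?_, ?_⟩⟩
  · filter_upwards [nhdsWithin_le_nhds (hst.eventually hψ), nhdsWithin_le_nhds hsr,
      self_mem_nhdsWithin] with t h1 h2 h3
    rw [h2] at h1
    have h4 : sphereCoord (f (e.symm (s t))) = (t ^ (k + 1))⁻¹ := by
      rw [← h1]
      simp [hΦ, sphereCoordInv]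
    have h5 : f (e.symm (s t)) ≠ OnePoint.infty := by
      intro h
      rw [h, sphereCoord_infty] at h4
      exact inv_ne_zero (pow_ne_zero _ h3) h4.symm
    rw [← coe_sphereCoord h5, h4]
  · have h1 := eventually_fibre (f := f) (y := OnePoint.infty)
      (P := fun q => q ∈ e.source ∧ s (ψ (e q)) = e q ∧ Φ (e q) = ψ (e q) ^ (k + 1))
      hf.continuous (by
        intro p hp
        have : p = w := by
          have : p ∈ f ⁻¹' {OnePoint.infty} := hp
          rwa [hw] at this
        rw [this]
        have hc := e.continuousAt (mem_chart_source ℂ w)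
        exact (e.open_source.eventually_mem (mem_chart_source ℂ w)).and
          ((hc.eventually hsl).and (hc.eventually hψ)))
    have h2 := (OnePoint.tendsto_coe_infty (X := ℂ)).eventually h1
    rw [coclosedCompact_eq_cocompact] at h2
    filter_upwards [(tendsto_inv_pow_cocompact k).eventually h2] with t ht q hq
    obtain ⟨h3, h4, h5⟩ := ht q hq
    refine ⟨ψ (e q), by rw [h4, e.left_inv h3], ?_⟩
    rw [← h5]
    simp [hΦ, e.left_inv h3, hq, sphereCoordInv]

/-- The quotient `η / df` in terms of the parameter `t`: there `η` is `h (s t) * s' t dt`, and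
`df` is `-(k + 1) / t ^ (k + 2) dt`. -/
theorem PoleParam.quotDeriv_eq [IsManifold 𝓘(ℂ) 1 C] {w : C} (P : PoleParam f w)
    (hf : IsHolomorphicToSphere f)
    (η : holForms C) :
    ∀ᶠ t in 𝓝[≠] (0 : ℂ), quotDeriv η f ((chartAt ℂ w).symm (P.s t)) =
      formCoeff η.1 (chartAt ℂ w) (P.s t) * deriv P.s t * (-(t ^ (P.k + 2)) / (P.k + 1)) ∧
      deriv P.s t ≠ 0 := by
  have he : chartAt ℂ w ∈ atlas ℂ C := chart_mem_atlas ℂ w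
  have hev := P.apply_eq
  rw [eventually_nhdsWithin_iff] at hev
  filter_upwards [nhdsWithin_le_nhds hev.eventually_nhds, nhdsWithin_le_nhds P.s_mem,
    nhdsWithin_le_nhds P.analyticAt_s.eventually_analyticAt, self_mem_nhdsWithin] with t h1 h2 h3 h4
  have ht : t ≠ 0 := h4
  have hk : (P.k + 1 : ℂ) ≠ 0 := by exact_mod_cast P.k.succ_ne_zero
  have hi : f ((chartAt ℂ w).symm (P.s t)) ≠ OnePoint.infty := by
    rw [h1.self_of_nhds ht]; exact OnePoint.coe_ne_infty _
  have hG := (hf.analyticAt_sphereCoord he h2 hi).differentiableAt.hasDerivAt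
  have hcomp := HasDerivAt.comp t hG h3.differentiableAt.hasDerivAt
  have hexp : HasDerivAt (fun t : ℂ => (t ^ (P.k + 1))⁻¹)
      (-(((P.k + 1 : ℕ) : ℂ) * t ^ P.k) / (t ^ (P.k + 1)) ^ 2) t := by
    have := (hasDerivAt_pow (P.k + 1) t).fun_inv (pow_ne_zero _ ht)
    simpa using this
  have heq : ∀ᶠ u in 𝓝 t, (u ^ (P.k + 1))⁻¹ =
      ((fun w' => sphereCoord (f ((chartAt ℂ w).symm w'))) ∘ P.s) u := by
    filter_upwards [h1, isOpen_ne.mem_nhds ht] with u hu hu0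
    simp [hu hu0]
  have hprod := (hcomp.congr_of_eventuallyEq heq).unique hexp
  have hne : -(((P.k + 1 : ℕ) : ℂ) * t ^ P.k) / (t ^ (P.k + 1)) ^ 2 ≠ 0 := by
    push_cast
    exact div_ne_zero (neg_ne_zero.2 (mul_ne_zero hk (pow_ne_zero _ ht)))
      (pow_ne_zero _ (pow_ne_zero _ ht))
  rw [← hprod] at hne
  obtain ⟨hne1, hne2⟩ := mul_ne_zero_iff.1 hne
  refine ⟨?_, hne2⟩
  rw [hf.quotDeriv_symm η he h2 hi, div_eq_iff hne1]
  have h5 : deriv P.s t * deriv (fun w' => sphereCoord (f ((chartAt ℂ w).symm w'))) (P.s t) *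
      (-(t ^ (P.k + 2)) / (P.k + 1)) = 1 := by
    rw [mul_comm (deriv P.s t), hprod]
    push_cast
    field_simp
    ring
  linear_combination (-formCoeff η.1 (chartAt ℂ w) (P.s t)) * h5

/-- If the fibres of `f` have at most two points, the order of the pole is at most two. -/
theorem PoleParam.k_le {w : C} (P : PoleParam f w) (hcard : ∀ x, (f ⁻¹' {x}).encard ≤ 2) :
    P.k ≤ 1 := by
  by_contra! hk
  set ζ : ℂ := Complex.exp (2 * Real.pi * Complex.I / ((P.k + 1 : ℕ) : ℂ)) with hζdef
  have hζ : IsPrimitiveRoot ζ (P.k + 1) := Complex.isPrimitiveRoot_exp _ P.k.succ_ne_zero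
  have hζ0 : ζ ≠ 0 := hζ.ne_zero P.k.succ_ne_zero
  have hroot : ∀ i : ℕ, ∀ᶠ t in 𝓝[≠] (0 : ℂ),
      f ((chartAt ℂ w).symm (P.s (ζ ^ i * t))) = (((t ^ (P.k + 1))⁻¹ : ℂ) : OnePoint ℂ) ∧
      P.ψ (P.s (ζ ^ i * t)) = ζ ^ i * t ∧ P.s (ζ ^ i * t) ∈ (chartAt ℂ w).target := by
    intro i
    have h1 := tendsto_mul_left_nhdsNE_zero (pow_ne_zero i hζ0)
    filter_upwards [h1.eventually P.apply_eq, h1.eventually (nhdsWithin_le_nhds P.ψ_s),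
      h1.eventually (nhdsWithin_le_nhds P.s_mem)] with t h2 h3 h4
    refine ⟨?_, h3, h4⟩
    rw [h2, mul_pow, ← pow_mul, mul_comm i, pow_mul, hζ.pow_eq_one, one_pow, one_mul]
  have hev := ((hroot 0).and ((hroot 1).and (hroot 2))).and self_mem_nhdsWithin
  obtain ⟨t, ⟨⟨h0, h0', h0''⟩, ⟨h1, h1', h1''⟩, h2, h2', h2''⟩, ht⟩ := hev.exists
  have ht0 : t ≠ 0 := ht
  have hne : ∀ i j : ℕ, i < P.k + 1 → j < P.k + 1 → i ≠ j →
      P.ψ (P.s (ζ ^ i * t)) = ζ ^ i * t → P.ψ (P.s (ζ ^ j * t)) = ζ ^ j * t →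
      P.s (ζ ^ i * t) ∈ (chartAt ℂ w).target → P.s (ζ ^ j * t) ∈ (chartAt ℂ w).target →
      (chartAt ℂ w).symm (P.s (ζ ^ i * t)) ≠ (chartAt ℂ w).symm (P.s (ζ ^ j * t)) := by
    intro i j hi hj hij hpi hpj hti htj h
    have h3 := (chartAt ℂ w).symm.injOn hti htj h
    rw [h3, hpj] at hpi
    exact hij (hζ.pow_inj hi hj (mul_right_cancel₀ ht0 hpi.symm))
  have h3 : ({(chartAt ℂ w).symm (P.s (ζ ^ 0 * t)), (chartAt ℂ w).symm (P.s (ζ ^ 1 * t)),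
      (chartAt ℂ w).symm (P.s (ζ ^ 2 * t))} : Set C).encard = 3 :=
    encard_eq_three.2 ⟨_, _, _, hne 0 1 (by omega) (by omega) (by omega) h0' h1' h0'' h1'',
      hne 0 2 (by omega) (by omega) (by omega) h0' h2' h0'' h2'',
      hne 1 2 (by omega) (by omega) (by omega) h1' h2' h1'' h2'', rfl⟩
  have h4 := encard_le_encard (t := f ⁻¹' {(((t ^ (P.k + 1))⁻¹ : ℂ) : OnePoint ℂ)})
    (s := {(chartAt ℂ w).symm (P.s (ζ ^ 0 * t)), (chartAt ℂ w).symm (P.s (ζ ^ 1 * t)),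
      (chartAt ℂ w).symm (P.s (ζ ^ 2 * t))}) (by
        rintro q (rfl | rfl | rfl)
        exacts [h0, h1, h2])
  rw [h3] at h4
  exact absurd (h4.trans (hcard _)) (by decide)

theorem PoleParam.eventually_fibreTrace_eq_zero [IsManifold 𝓘(ℂ) 1 C] [CompactSpace C] [T2Space C]
    {w : C}
    (P : PoleParam f w) (hf : IsHolomorphicToSphere f) (hcard : ∀ x, (f ⁻¹' {x}).encard ≤ 2)
    (η : holForms C) :
    ∀ᶠ t in 𝓝[≠] (0 : ℂ), fibreTrace f (quotDeriv η f) (t ^ (P.k + 1))⁻¹ = 0 := by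
  obtain ⟨B, hB⟩ := hf.exists_fibreTrace_eq_zero hcard η
  have h1 : (↑B : Set ℂ)ᶜ ∈ cocompact ℂ := B.finite_toSet.isCompact.compl_mem_cocompact
  filter_upwards [(tendsto_inv_pow_cocompact P.k).eventually h1] with t ht
  exact hB _ ht

/-- A simple pole is impossible in the presence of a nonzero holomorphic one-form `η`: the fibres
near the pole would be single points, and the vanishing of traces would make `η` zero there. -/
theorem PoleParam.k_ne_zero [IsManifold 𝓘(ℂ) 1 C] [CompactSpace C] [T2Space C] [ConnectedSpace C]
    {w : C}
    (P : PoleParam f w) (hf : IsHolomorphicToSphere f) (hcard : ∀ x, (f ⁻¹' {x}).encard ≤ 2)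
    {η : holForms C} (hη : η ≠ 0) (hηw : formCoeff η.1 (chartAt ℂ w) (chartAt ℂ w w) = 0) :
    P.k ≠ 0 := by
  intro hk
  apply hη
  have h1 : ∀ᶠ t in 𝓝[≠] (0 : ℂ), formCoeff η.1 (chartAt ℂ w) (P.s t) = 0 := by
    filter_upwards [P.quotDeriv_eq hf η, P.eventually_fibreTrace_eq_zero hf hcard η, P.apply_eq,
      P.fibre, self_mem_nhdsWithin] with t h1 h2 h3 h4 h5
    have ht : t ≠ 0 := h5
    have hfib : f ⁻¹' {(((t ^ (P.k + 1))⁻¹ : ℂ) : OnePoint ℂ)} =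
        {(chartAt ℂ w).symm (P.s t)} := by
      ext q
      constructor
      · intro hq
        obtain ⟨t', hq', ht'⟩ := h4 q hq
        rw [hk, zero_add, pow_one, pow_one] at ht'
        rw [hq', ht']
        rfl
      · rintro rfl
        exact h3
    rw [fibreTrace, hfib, finsum_mem_singleton, h1.1] at h2
    have hne : -(t ^ (P.k + 2)) / (P.k + 1 : ℂ) ≠ 0 :=
      div_ne_zero (neg_ne_zero.2 (pow_ne_zero _ ht)) (by exact_mod_cast P.k.succ_ne_zero)
    exact (mul_eq_zero.1 ((mul_eq_zero.1 h2).resolve_right hne)).resolve_right h1.2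
  have h2 : ∀ᶠ t in 𝓝 (0 : ℂ), formCoeff η.1 (chartAt ℂ w) (P.s t) = 0 := by
    rw [eventually_nhdsWithin_iff] at h1
    filter_upwards [h1] with t ht
    by_cases h : t = 0
    · rw [h, P.s_zero, hηw]
    · exact ht h
  have h3 : ∀ᶠ z in 𝓝 (chartAt ℂ w w), formCoeff η.1 (chartAt ℂ w) z = 0 := by
    have := P.analyticAt_ψ.continuousAt.tendsto
    rw [P.ψ_pole] at this
    filter_upwards [this.eventually h2, P.s_ψ] with z hz hz'
    rwa [hz'] at hz
  refine holForm_eq_zero_of_eventually η (p := w) ?_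
  filter_upwards [((chartAt ℂ w).continuousAt (mem_chart_source ℂ w)).eventually h3,
    chart_source_mem_nhds ℂ w] with q hq hqs
  rw [formCoeff_eq_mul, mul_eq_zero, or_iff_right
    (coordFactor_ne_zero (chart_mem_atlas ℂ w) ((chartAt ℂ w).map_source hqs)),
    (chartAt ℂ w).left_inv hqs] at hq
  exact hq

/-- A holomorphic one-form is odd under the exchange of the two points of the fibres of `f`.
Hence, if it vanishes at the pole of `f`, it does so to the second order, and `f η` is holomorphic
there. -/
theorem IsHolomorphicToSphere.exists_extension_mul [IsManifold 𝓘(ℂ) 1 C] [CompactSpace C]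
    [T2Space C] [ConnectedSpace C]
    (hf : IsHolomorphicToSphere f) (hcard : ∀ x, (f ⁻¹' {x}).encard ≤ 2) {w : C}
    (hw : f ⁻¹' {OnePoint.infty} = {w})
    {η : holForms C} (hη : η ≠ 0) (hηw : formCoeff η.1 (chartAt ℂ w) (chartAt ℂ w w) = 0) :
    ∃ R : ℂ → ℂ, AnalyticAt ℂ R (chartAt ℂ w w) ∧ ∀ᶠ z in 𝓝[≠] (chartAt ℂ w w),
      sphereCoord (f ((chartAt ℂ w).symm z)) * formCoeff η.1 (chartAt ℂ w) z = R z := by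
  have hfin : ∀ x, (f ⁻¹' {x}).Finite := fun x =>
    finite_of_encard_le_coe (k := 2) (by simpa using hcard x)
  obtain ⟨P⟩ := hf.exists_poleParam hfin hw
  have hk : P.k = 1 := by
    have h1 := P.k_le hcard
    have h2 := P.k_ne_zero hf hcard hη hηw
    omega
  -- In the parameter `t`, the form is `H t dt` and the points of a fibre are `t` and `-t`. Since
  -- the traces vanish, `H` is even.
  set H : ℂ → ℂ := fun t => formCoeff η.1 (chartAt ℂ w) (P.s t) * deriv P.s t with hH
  have hHa : AnalyticAt ℂ H 0 := by
    refine AnalyticAt.mul (AnalyticAt.comp (g := formCoeff η.1 (chartAt ℂ w)) ?_ P.analyticAt_s)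
      P.analyticAt_s.deriv
    rw [P.s_zero]
    exact analyticAt_formCoeff η (chart_mem_atlas ℂ w) (mem_chart_target ℂ w)
  have hH0 : H 0 = 0 := by simp [hH, P.s_zero, hηw]
  have hneg : Tendsto (fun t : ℂ => -t) (𝓝[≠] 0) (𝓝[≠] 0) := by
    simpa using tendsto_mul_left_nhdsNE_zero (c := -1) (by norm_num)
  have heven : ∀ᶠ t in 𝓝 0, H (-t) = H t := by
    have h1 : ∀ᶠ t in 𝓝[≠] 0, H (-t) = H t := by
      filter_upwards [P.quotDeriv_eq hf η, hneg.eventually (P.quotDeriv_eq hf η),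
        P.eventually_fibreTrace_eq_zero hf hcard η, P.apply_eq, hneg.eventually P.apply_eq,
        P.fibre, self_mem_nhdsWithin, nhdsWithin_le_nhds P.ψ_s,
        hneg.eventually (nhdsWithin_le_nhds P.ψ_s), nhdsWithin_le_nhds P.s_mem,
        hneg.eventually (nhdsWithin_le_nhds P.s_mem)]
        with t h1 h2 h3 h4 h5 h6 h7 h8 h9 h10 h11
      have ht : t ≠ 0 := h7
      have hne : (chartAt ℂ w).symm (P.s t) ≠ (chartAt ℂ w).symm (P.s (-t)) := by
        intro h
        have h12 := (chartAt ℂ w).symm.injOn h10 h11 h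
        rw [h12, h9] at h8
        exact ht (by linear_combination (-1 / 2 : ℂ) * h8)
      have hfib : f ⁻¹' {(((t ^ (P.k + 1))⁻¹ : ℂ) : OnePoint ℂ)} =
          {(chartAt ℂ w).symm (P.s t), (chartAt ℂ w).symm (P.s (-t))} := by
        ext q
        constructor
        · intro hq
          obtain ⟨t', hq', ht'⟩ := h6 q hq
          rw [hk] at ht'
          rcases sq_eq_sq_iff_eq_or_eq_neg.1 ht' with h | h
          · left; rw [hq', h]
          · right; rw [hq', h]; rfl
        · rintro (rfl | rfl)
          · exact h4
          · rw [hk] at h5 ⊢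
            rw [neg_pow, neg_one_sq, one_mul] at h5
            exact h5
      rw [fibreTrace, hfib, finsum_mem_pair hne, h1.1, h2.1, hk] at h3
      have h12 : t ^ 3 * (H (-t) - H t) = 0 := by
        simp only [hH]
        norm_num at h3
        linear_combination 2 * h3
      exact sub_eq_zero.1 ((mul_eq_zero.1 h12).resolve_left (pow_ne_zero _ ht))
    rw [eventually_nhdsWithin_iff] at h1
    filter_upwards [h1] with t ht
    by_cases h : t = 0
    · rw [h, neg_zero]
    · exact ht h
  obtain ⟨K, hK, hHK⟩ := exists_eventually_eq_sq_mul_of_even hHa hH0 heven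
  have hs' : deriv P.s 0 ≠ 0 := by
    have h1 := P.analyticAt_ψ.differentiableAt.hasDerivAt
    have h2 := P.analyticAt_s.differentiableAt.hasDerivAt
    rw [← P.ψ_pole] at h2
    have h3 := (HasDerivAt.comp (chartAt ℂ w w) h2 h1).congr_of_eventuallyEq
      (f₁ := id) (by filter_upwards [P.s_ψ] with z hz using hz.symm)
    have h4 := h3.unique (hasDerivAt_id _)
    rw [P.ψ_pole] at h4
    exact left_ne_zero_of_mul_eq_one h4
  have hψt : Tendsto P.ψ (𝓝 (chartAt ℂ w w)) (𝓝 0) := by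
    have := P.analyticAt_ψ.continuousAt.tendsto
    rwa [P.ψ_pole] at this
  refine ⟨fun z => K (P.ψ z) / deriv P.s (P.ψ z), ?_, ?_⟩
  · refine AnalyticAt.div (AnalyticAt.comp (g := K) (by rwa [P.ψ_pole]) P.analyticAt_ψ)
      (AnalyticAt.comp (g := deriv P.s) ?_ P.analyticAt_ψ) (by rwa [P.ψ_pole])
    rw [P.ψ_pole]
    exact P.analyticAt_s.deriv
  · have hs'ev : ∀ᶠ t in 𝓝 0, deriv P.s t ≠ 0 :=
      P.analyticAt_s.deriv.continuousAt.eventually_ne hs'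
    filter_upwards [nhdsWithin_le_nhds P.s_ψ, nhdsWithin_le_nhds P.inv_eq,
      nhdsWithin_le_nhds (hψt.eventually hs'ev), self_mem_nhdsWithin] with z h1 h2 h3 h4
    have hψne : P.ψ z ≠ 0 := by
      intro h
      rw [h, P.s_zero] at h1
      exact h4 h1.symm
    have h5 := hHK (P.ψ z)
    simp only [hH, h1] at h5
    rw [hk] at h2
    have h6 : sphereCoord (f ((chartAt ℂ w).symm z)) = (P.ψ z ^ 2)⁻¹ := by
      rw [← h2, sphereCoordInv, inv_inv]
    rw [h6, eq_div_iff h3, mul_assoc, h5]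
    field_simp

/-- On a curve with two independent holomorphic one-forms, there are holomorphic one-forms `η ≠ 0`
and `ζ` such that `ζ = f η`. -/
theorem IsHolomorphicToSphere.exists_holForms_mul [IsManifold 𝓘(ℂ) 1 C] [CompactSpace C] [T2Space C]
    [ConnectedSpace C]
    (hf : IsHolomorphicToSphere f) (hcard : ∀ x, (f ⁻¹' {x}).encard ≤ 2) {w : C}
    (hw : f ⁻¹' {OnePoint.infty} = {w}) (hrank : 2 ≤ Module.finrank ℂ (holForms C)) :
    ∃ η ζ : holForms C, η ≠ 0 ∧ ∀ p ≠ w, ζ.1 p = sphereCoord (f p) • η.1 p := by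
  classical
  set e := chartAt ℂ w with hedef
  have he : e ∈ atlas ℂ C := chart_mem_atlas ℂ w
  have hz : e w ∈ e.target := mem_chart_target ℂ w
  have hws : e.symm (e w) = w := e.left_inv (mem_chart_source ℂ w)
  -- vanishing at `w` is one linear condition on the space of holomorphic one-forms
  obtain ⟨η, hη, hηw⟩ : ∃ η : holForms C, η ≠ 0 ∧ formCoeff η.1 e (e w) = 0 := by
    have : FiniteDimensional ℂ (holForms C) := FiniteDimensional.of_finrank_pos (by omega)
    let l : holForms C →ₗ[ℂ] ℂ :=
      { toFun := fun η => formCoeff η.1 e (e w)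
        map_add' := fun _ _ => rfl
        map_smul' := fun _ _ => rfl }
    have h1 : LinearMap.ker l ≠ ⊥ := by
      refine LinearMap.ker_ne_bot_of_finrank_lt (K := ℂ) (V := holForms C) (V₂ := ℂ) (f := l) ?_
      rw [Module.finrank_self]
      exact hrank
    obtain ⟨η, hη, hη0⟩ := Submodule.exists_mem_ne_zero_of_ne_bot h1
    exact ⟨η, hη0, hη⟩
  obtain ⟨R, hR, hRe⟩ := hf.exists_extension_mul hcard hw hη hηw
  rw [← hedef] at hR hRe
  -- the coefficient of `f η` is removable at `w`, with the value `R (e w)`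
  let ζ : ∀ p : C, TangentSpace 𝓘(ℂ) p →L[ℂ] ℂ := fun p =>
    if p = w then (R (e w) • ContinuousLinearMap.id ℂ ℂ : ℂ →L[ℂ] ℂ)
    else sphereCoord (f p) • η.1 p
  have hζ : ∀ p ≠ w, ζ p = sphereCoord (f p) • η.1 p := fun p hp => if_neg hp
  have hmul : ∀ (e' : OpenPartialHomeomorph C ℂ) (z : ℂ), e'.symm z ≠ w →
      formCoeff ζ e' z = sphereCoord (f (e'.symm z)) * formCoeff η.1 e' z := by
    intro e' z hne
    rw [formCoeff, hζ _ hne]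
    rfl
  refine ⟨η, ⟨ζ, mem_holForms_of_differentiableAt fun p => ?_⟩, hη, hζ⟩
  by_cases hp : p = w
  · subst hp
    refine hR.differentiableAt.congr_of_eventuallyEq ?_
    rw [eventually_nhdsWithin_iff] at hRe
    filter_upwards [hRe, e.open_target.mem_nhds hz] with z h1 h2
    by_cases hzw : z = e p
    · rw [hzw, formCoeff_chartAt]
      have : ζ p = (R (e p) • ContinuousLinearMap.id ℂ ℂ : ℂ →L[ℂ] ℂ) := if_pos rfl
      rw [this]
      exact mul_one (R (e p))
    · have hne : e.symm z ≠ p := by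
        intro h
        apply hzw
        rw [← h, e.right_inv h2]
      rw [hmul e z hne]
      exact h1 hzw
  · set e' := chartAt ℂ p
    have he' : e' ∈ atlas ℂ C := chart_mem_atlas ℂ p
    have hz' : e' p ∈ e'.target := mem_chart_target ℂ p
    have hps : e'.symm (e' p) = p := e'.left_inv (mem_chart_source ℂ p)
    have hpi : f (e'.symm (e' p)) ≠ OnePoint.infty := by
      rw [hps]
      intro h
      have : p ∈ f ⁻¹' {OnePoint.infty} := h
      rw [hw] at this
      exact hp this
    have h1 := (hf.analyticAt_sphereCoord he' hz' hpi).differentiableAt.mul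
      (analyticAt_formCoeff η he' hz').differentiableAt
    refine h1.congr_of_eventuallyEq ?_
    filter_upwards [eventually_symm_mem hz' (isOpen_ne.mem_nhds
      (show e'.symm (e' p) ≠ w by rwa [hps]))] with z hz
    exact hmul e' z hz.2

end Pole

/-! ### Integration of two-forms -/

section Integration

variable {C : Type*} [TopologicalSpace C] [ChartedSpace ℂ C]

theorem TwoForm.coeff_add (β γ : TwoForm C) (e : OpenPartialHomeomorph C ℂ) (z : ℂ) :
    (β + γ).coeff e z = β.coeff e z + γ.coeff e z := rfl

theorem TwoForm.coeff_smul (c : ℂ) (β : TwoForm C) (e : OpenPartialHomeomorph C ℂ) (z : ℂ) :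
    (c • β).coeff e z = c * β.coeff e z := rfl

/-- The integrand of the `i`-th summand in the integral of a two-form. -/
noncomputable def TwoForm.integrand [CompactSpace C] [T2Space C] (β : TwoForm C) (i : C)
    (z : ℂ) : ℂ :=
  (chartPartition C i ((chartAt ℂ i).symm z) : ℂ) * β.coeff (chartAt ℂ i) z

theorem finite_chartPartition_ne_zero (C : Type*) [TopologicalSpace C] [ChartedSpace ℂ C]
    [CompactSpace C] [T2Space C] : {i : C | chartPartition C i ≠ 0}.Finite := by
  refine ((chartPartition C).locallyFinite.finite_nonempty_of_compact).subset fun i hi => ?_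
  by_contra h
  rw [mem_ofPred_eq, not_nonempty_iff_eq_empty, Function.support_eq_empty_iff] at h
  exact hi (ContinuousMap.ext fun p => congrFun h p)

theorem TwoForm.integral_eq_sum [CompactSpace C] [T2Space C] (β : TwoForm C) :
    β.integral = ∑ i ∈ (finite_chartPartition_ne_zero C).toFinset,
      ∫ z in (chartAt ℂ i).target, β.integrand i z := by
  refine finsum_eq_sum_of_support_subset _ fun i hi => ?_
  rw [Finite.coe_toFinset]
  intro h
  apply hi
  simp [h]

theorem TwoForm.IsIntegrable.add [CompactSpace C] [T2Space C] {β γ : TwoForm C}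
    (hβ : β.IsIntegrable) (hγ : γ.IsIntegrable) :
    (β + γ).IsIntegrable := by
  intro i
  refine ((hβ i).add (hγ i)).congr (Eventually.of_forall fun z => ?_)
  simp only [Pi.add_apply, TwoForm.coeff_add, mul_add]

theorem TwoForm.IsIntegrable.smul [CompactSpace C] [T2Space C] {β : TwoForm C} (c : ℂ)
    (hβ : β.IsIntegrable) :
    (c • β).IsIntegrable := by
  intro i
  refine Integrable.congr (Integrable.const_mul (hβ i) c) (Eventually.of_forall fun z => ?_)
  simp only [TwoForm.coeff_smul]
  ring

theorem TwoForm.integral_add [CompactSpace C] [T2Space C] {β γ : TwoForm C} (hβ : β.IsIntegrable)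
    (hγ : γ.IsIntegrable) :
    (β + γ).integral = β.integral + γ.integral := by
  rw [TwoForm.integral_eq_sum, TwoForm.integral_eq_sum, TwoForm.integral_eq_sum,
    ← Finset.sum_add_distrib]
  refine Finset.sum_congr rfl fun i _ => ?_
  simp only [TwoForm.integrand, TwoForm.coeff_add, mul_add]
  exact MeasureTheory.integral_add (hβ i) (hγ i)

theorem TwoForm.integral_smul [CompactSpace C] [T2Space C] (c : ℂ) (β : TwoForm C) :
    (c • β).integral = c * β.integral := by
  rw [TwoForm.integral_eq_sum, TwoForm.integral_eq_sum, Finset.mul_sum]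
  refine Finset.sum_congr rfl fun i _ => ?_
  rw [← MeasureTheory.integral_const_mul]
  simp only [TwoForm.integrand, TwoForm.coeff_smul]
  congr 1
  funext z
  ring

theorem ae_symm_notMem (i : C) {S : Set C} (hS : S.Finite) :
    ∀ᵐ z ∂(volume.restrict (chartAt ℂ i).target), (chartAt ℂ i).symm z ∉ S := by
  have hfin : ((chartAt ℂ i) '' S).Finite := hS.image _
  have h1 : ∀ᵐ z ∂(volume.restrict (chartAt ℂ i).target), z ∉ (chartAt ℂ i) '' S :=
    ae_restrict_of_ae (hfin.countable.ae_notMem volume)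
  filter_upwards [h1, ae_restrict_mem (chartAt ℂ i).open_target.measurableSet] with z hz hzt h
  exact hz ⟨_, h, (chartAt ℂ i).right_inv hzt⟩

/-- The form `u a ∧ conj b`. -/
noncomputable def weightedForm (u : C → ℝ) (a b : holForms C) : TwoForm C :=
  fun p => u p • wedgeConj (a.1 p).toLinearMap (b.1 p).toLinearMap

theorem coeff_weightedForm (u : C → ℝ) (a b : holForms C) (e : OpenPartialHomeomorph C ℂ) (z : ℂ) :
    (weightedForm u a b).coeff e z = (u (e.symm z) : ℂ) *
      (-2 * Complex.I * (formCoeff a.1 e z * (starRingEnd ℂ) (formCoeff b.1 e z))) := by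
  have hI : ∀ c : holForms C, c.1 (e.symm z) (coordVec e z Complex.I) =
      Complex.I * formCoeff c.1 e z := by
    intro c
    rw [coordVec_smul]
    exact (c.1 (e.symm z)).map_smul _ _
  have h1 : (weightedForm u a b).coeff e z = (u (e.symm z) : ℂ) *
      (a.1 (e.symm z) (coordVec e z 1) * (starRingEnd ℂ) (b.1 (e.symm z) (coordVec e z Complex.I)) -
        a.1 (e.symm z) (coordVec e z Complex.I) * (starRingEnd ℂ)
            (b.1 (e.symm z) (coordVec e z 1))) :=
    rfl
  rw [h1, hI, hI, map_mul, Complex.conj_I]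
  simp only [formCoeff]
  ring

/-- The weighted inner product `(i/2) ∫ u a ∧ conj b`. -/
noncomputable def weightedInner [CompactSpace C] [T2Space C] (u : C → ℝ) (a b : holForms C) : ℂ :=
  Complex.I / 2 * (weightedForm u a b).integral

theorem weightedForm_add_left (u : C → ℝ) (a a' b : holForms C) :
    weightedForm u (a + a') b = weightedForm u a b + weightedForm u a' b := by
  funext p
  ext v
  change u p • ((a.1 p (v 0) + a'.1 p (v 0)) * _ - (a.1 p (v 1) + a'.1 p (v 1)) * _) =
    u p • (a.1 p (v 0) * _ - a.1 p (v 1) * _) + u p • (a'.1 p (v 0) * _ - a'.1 p (v 1) * _)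
  simp only [Complex.real_smul]
  ring

theorem weightedForm_smul_left (u : C → ℝ) (c : ℂ) (a b : holForms C) :
    weightedForm u (c • a) b = c • weightedForm u a b := by
  funext p
  ext v
  change u p • ((c * a.1 p (v 0)) * _ - (c * a.1 p (v 1)) * _) =
    c * (u p • (a.1 p (v 0) * _ - a.1 p (v 1) * _))
  simp only [Complex.real_smul]
  ring

theorem weightedInner_conj_symm [CompactSpace C] [T2Space C] (u : C → ℝ) (a b : holForms C) :
    (starRingEnd ℂ) (weightedInner u b a) = weightedInner u a b := by
  simp only [weightedInner, TwoForm.integral_eq_sum, Finset.mul_sum, map_sum, map_mul]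
  refine Finset.sum_congr rfl fun i _ => ?_
  rw [← map_mul, ← MeasureTheory.integral_const_mul, ← MeasureTheory.integral_const_mul,
    ← integral_conj]
  congr 1
  funext z
  simp only [TwoForm.integrand, coeff_weightedForm, map_mul, map_div₀, Complex.conj_I,
    Complex.conj_ofReal, Complex.conj_conj, map_neg, Complex.conj_ofNat]
  ring

/-- A real function on the curve is an admissible weight if it is locally integrable in all
charts. -/
def IsWeight (u : C → ℝ) : Prop :=
  ∀ e ∈ atlas ℂ C, ∀ z ∈ e.target, IntegrableAtFilter (fun w => u (e.symm w)) (𝓝 z)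

/-- The integrals defining the weighted inner products converge absolutely: in each chart, the
partition of unity cuts out a compact set, on which the coefficients are bounded. -/
theorem IsWeight.isIntegrable [CompactSpace C] [T2Space C] {u : C → ℝ} (hu : IsWeight u)
    (a b : holForms C) :
    (weightedForm u a b).IsIntegrable := by
  intro i
  set e := chartAt ℂ i
  have he : e ∈ atlas ℂ C := chart_mem_atlas ℂ i
  set ρ := chartPartition C i with hρ
  have hsub : tsupport ρ ⊆ e.source := (exists_chartPartition C).choose_spec i
  set K : Set ℂ := e '' tsupport ρ
  have hK : IsCompact K :=
    (isClosed_tsupport ρ).isCompact.image_of_continuousOn (e.continuousOn.mono hsub)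
  have hKt : K ⊆ e.target := by
    rintro _ ⟨p, hp, rfl⟩
    exact e.map_source (hsub hp)
  set c : ℂ → ℂ := fun z => (ρ (e.symm z) : ℂ) *
    (-2 * Complex.I * (formCoeff a.1 e z * (starRingEnd ℂ) (formCoeff b.1 e z))) with hc
  have hcc : ContinuousOn c e.target := by
    refine ContinuousOn.mul ?_ (ContinuousOn.mul continuousOn_const (ContinuousOn.mul ?_ ?_))
    · exact Complex.continuous_ofReal.comp_continuousOn
        (ρ.continuous.comp_continuousOn e.continuousOn_symm)
    · exact fun z hz => (analyticAt_formCoeff a he hz).continuousAt.continuousWithinAt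
    · exact Complex.continuous_conj.comp_continuousOn
        fun z hz => (analyticAt_formCoeff b he hz).continuousAt.continuousWithinAt
  have heq : (fun z : ℂ => (ρ (e.symm z) : ℂ) * (weightedForm u a b).coeff e z) =
      fun z => c z * (u (e.symm z) : ℂ) := by
    funext z
    rw [coeff_weightedForm]
    simp only [hc]
    ring
  rw [heq]
  refine IntegrableOn.of_forall_sdiff_eq_zero (s := K) ?_ e.open_target.measurableSet ?_
  · refine LocallyIntegrableOn.integrableOn_isCompact ?_ hK
    intro z hz
    have hzt := hKt hz
    obtain ⟨s, hs, hsi⟩ := hu e he z hzt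
    obtain ⟨r, hr, hball⟩ := Metric.nhds_basis_closedBall.mem_iff.1
      (inter_mem hs (e.open_target.mem_nhds hzt))
    refine IntegrableAtFilter.filter_mono nhdsWithin_le_nhds
      ⟨Metric.closedBall z r, Metric.closedBall_mem_nhds z hr, ?_⟩
    refine IntegrableOn.continuousOn_mul (hcc.mono (hball.trans inter_subset_right)) ?_
      (isCompact_closedBall z r)
    exact (hsi.mono_set (hball.trans inter_subset_left)).ofReal
  · rintro z ⟨hz, hzK⟩
    have h0 : ρ (e.symm z) = 0 := by
      by_contra h
      exact hzK ⟨e.symm z, subset_tsupport _ h, e.right_inv hz⟩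
    simp [hc, h0]

theorem isWeight_one : IsWeight (fun _ : C => (1 : ℝ)) := by
  intro e _ z _
  exact ⟨Metric.ball z 1, Metric.ball_mem_nhds z one_pos,
    integrableOn_const (by simp) (by simp)⟩

/-- The logarithmic singularities of `log |f|` at its zeros and poles are integrable. -/
theorem IsHolomorphicToSphere.isWeight_logAbs [IsManifold 𝓘(ℂ) 1 C] {f : C → OnePoint ℂ}
    (hf : IsHolomorphicToSphere f) (hfin : ∀ x, (f ⁻¹' {x}).Finite) :
    IsWeight fun p => logAbs (f p) := by
  intro e he z hz
  by_cases hp : f (e.symm z) = OnePoint.infty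
  · have h0 : f (e.symm z) ≠ ((0 : ℂ) : OnePoint ℂ) := by rw [hp]; exact OnePoint.infty_ne_coe _
    obtain ⟨s, hs, hsi⟩ := exists_integrableOn_log_norm (hf.analyticAt_sphereCoordInv he hz h0)
      (hf.not_eventually_sphereCoordInv_eq hfin hz hp)
    refine ⟨s, hs, hsi.neg.congr (Eventually.of_forall fun w => ?_)⟩
    simp [logAbs, sphereCoordInv, Real.log_inv]
  · exact exists_integrableOn_log_norm (hf.analyticAt_sphereCoord he hz hp)
      (hf.not_eventually_sphereCoord_eq hfin hz hp 0)

theorem IsWeight.weightedInner_add_left [CompactSpace C] [T2Space C] {u : C → ℝ} (hu : IsWeight u)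
    (a a' b : holForms C) :
    weightedInner u (a + a') b = weightedInner u a b + weightedInner u a' b := by
  rw [weightedInner, weightedForm_add_left,
    TwoForm.integral_add (hu.isIntegrable a b) (hu.isIntegrable a' b), mul_add]
  rfl

theorem weightedInner_smul_left [CompactSpace C] [T2Space C] (u : C → ℝ) (c : ℂ)
    (a b : holForms C) :
    weightedInner u (c • a) b = c * weightedInner u a b := by
  rw [weightedInner, weightedForm_smul_left, TwoForm.integral_smul, weightedInner]
  ring

theorem eventually_holForm_ne_zero [IsManifold 𝓘(ℂ) 1 C] {η : holForms C} (hη : η ≠ 0) :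
    ∃ p, ∀ᶠ q in 𝓝 p, η.1 q (1 : ℂ) ≠ 0 := by
  obtain ⟨p, hp⟩ : ∃ p, η.1 p (1 : ℂ) ≠ 0 := by
    by_contra! h
    apply hη
    ext q : 2
    refine ContinuousLinearMap.ext fun v => ?_
    refine (covector_apply_eq_mul (η.1 q) v).trans ?_
    rw [h q]
    exact @mul_zero ℂ _ v
  refine ⟨p, ?_⟩
  have h1 := (analyticAt_formCoeff η (chart_mem_atlas ℂ p) (mem_chart_target ℂ p)).continuousAt
  have h2 := h1.eventually_ne (y := 0) (by rwa [formCoeff_chartAt])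
  filter_upwards [((chartAt ℂ p).continuousAt (mem_chart_source ℂ p)).eventually h2,
    chart_source_mem_nhds ℂ p] with q hq hqs
  rw [formCoeff_eq_mul, (chartAt ℂ p).left_inv hqs] at hq
  exact right_ne_zero_of_mul hq

/-- **Positivity of the integral**: if a form equals `u η ∧ conj η` off a finite set, with a
nonnegative weight `u`, then `i/2` times its integral is positive as soon as `u η` has no zero on
some nonempty open set. -/
theorem TwoForm.IsIntegrable.re_pos [CompactSpace C] [T2Space C] [IsManifold 𝓘(ℂ) 1 C]
    {β : TwoForm C} (hβ : β.IsIntegrable)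
    (η : holForms C) (u : C → ℝ) {S : Set C} (hS : S.Finite)
    (heq : ∀ p ∉ S, β p = weightedForm u η η p) (hnn : ∀ p ∉ S, 0 ≤ u p)
    {p : C} (hp : ∀ᶠ q in 𝓝 p, 0 < u q ∧ η.1 q (1 : ℂ) ≠ 0) :
    0 < (Complex.I / 2 * β.integral).re := by
  set g : C → ℂ → ℝ := fun i z =>
    chartPartition C i ((chartAt ℂ i).symm z) * u ((chartAt ℂ i).symm z) *
      ‖formCoeff η.1 (chartAt ℂ i) z‖ ^ 2 with hg
  have hae : ∀ i, ∀ᵐ z ∂(volume.restrict (chartAt ℂ i).target),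
      (Complex.I / 2 * β.integrand i z) = (g i z : ℂ) ∧ 0 ≤ g i z := by
    intro i
    filter_upwards [ae_symm_notMem i hS] with z hz
    have h1 : β.coeff (chartAt ℂ i) z = (weightedForm u η η).coeff (chartAt ℂ i) z := by
      rw [TwoForm.coeff, heq _ hz]; rfl
    refine ⟨?_, mul_nonneg (mul_nonneg ((chartPartition C).nonneg i _) (hnn _ hz)) (sq_nonneg _)⟩
    rw [TwoForm.integrand, h1, coeff_weightedForm, Complex.mul_conj, Complex.normSq_eq_norm_sq]
    simp only [hg]
    push_cast
    linear_combination (-(chartPartition C i ((chartAt ℂ i).symm z) : ℂ) *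
      (u ((chartAt ℂ i).symm z) : ℂ) * (‖formCoeff η.1 (chartAt ℂ i) z‖ : ℂ) ^ 2) * Complex.I_sq
  have hint : ∀ i, Complex.I / 2 * ∫ z in (chartAt ℂ i).target, β.integrand i z =
      ((∫ z in (chartAt ℂ i).target, g i z : ℝ) : ℂ) := by
    intro i
    rw [← MeasureTheory.integral_const_mul, ← integral_complex_ofReal]
    exact integral_congr_ae ((hae i).mono fun z hz => hz.1)
  have hgint : ∀ i, IntegrableOn (g i) (chartAt ℂ i).target := by
    intro i
    refine ((hβ i).const_mul (Complex.I / 2)).re.congr ((hae i).mono fun z hz => ?_)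
    have := congrArg Complex.re hz.1
    rw [Complex.ofReal_re] at this
    exact this
  have hgnn : ∀ i, 0 ≤ᵐ[volume.restrict (chartAt ℂ i).target] g i :=
    fun i => (hae i).mono fun z hz => hz.2
  rw [TwoForm.integral_eq_sum, Finset.mul_sum, Finset.sum_congr rfl fun i _ => hint i,
    ← Complex.ofReal_sum, Complex.ofReal_re]
  obtain ⟨i, hi⟩ := (chartPartition C).exists_pos (mem_univ p)
  refine Finset.sum_pos' (fun j _ => integral_nonneg_of_ae (hgnn j)) ⟨i, ?_, ?_⟩
  · rw [Finite.mem_toFinset]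
    intro h
    rw [h] at hi
    exact lt_irrefl _ hi
  · have hps : p ∈ (chartAt ℂ i).source :=
      (exists_chartPartition C).choose_spec i (subset_tsupport _ hi.ne')
    rw [setIntegral_pos_iff_support_of_nonneg_ae (hgnn i) (hgint i)]
    have hmem : Function.support (g i) ∩ (chartAt ℂ i).target ∈ 𝓝 (chartAt ℂ i p) := by
      have hsym := (chartAt ℂ i).left_inv hps
      have hρ : ∀ᶠ q in 𝓝 p, 0 < chartPartition C i q :=
        (chartPartition C i).continuous.continuousAt.eventually (lt_mem_nhds hi)
      have h2 := (hp.and hρ)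
      rw [← hsym] at h2
      filter_upwards [eventually_symm_mem ((chartAt ℂ i).map_source hps) h2] with z hz
      refine ⟨?_, hz.1⟩
      have h3 := hz.2
      refine mul_ne_zero (mul_ne_zero h3.2.ne' h3.1.1.ne') (pow_ne_zero _ (norm_ne_zero_iff.2 ?_))
      rw [formCoeff_eq_mul]
      exact mul_ne_zero (coordFactor_ne_zero (chart_mem_atlas ℂ i) hz.1) h3.1.2
    exact Measure.measure_pos_of_mem_nhds volume hmem

end Integration

/-! ### Hermitian forms -/

section Hermitian

variable {V : Type*} [AddCommGroup V] [Module ℂ V]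

/-- A positive definite Hermitian form on a complex vector space of finite dimension has an
orthonormal basis. -/
theorem exists_orthonormal_basis [FiniteDimensional ℂ V] {g : ℕ} (hg : Module.finrank ℂ V = g)
    (N : V → V → ℂ) (hadd : ∀ x y z, N (x + y) z = N x z + N y z)
    (hsmul : ∀ (c : ℂ) x y, N (c • x) y = c * N x y)
    (hconj : ∀ x y, (starRingEnd ℂ) (N y x) = N x y) (hpos : ∀ x, x ≠ 0 → 0 < (N x x).re) :
    ∃ b : Module.Basis (Fin g) ℂ V, ∀ i j, N (b i) (b j) = if i = j then 1 else 0 := by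
  have h0 : N 0 0 = 0 := by simpa using hsmul 0 0 0
  let core : InnerProductSpace.Core ℂ V :=
    { inner := fun x y => N y x
      conj_inner_symm := fun x y => hconj y x
      re_inner_nonneg := fun x => by
        by_cases hx : x = 0
        · simp [hx, h0]
        · exact (hpos x hx).le
      add_left := fun x y z => by
        rw [← hconj, hadd, map_add, hconj, hconj]
      smul_left := fun x y c => by
        rw [← hconj, hsmul, map_mul, hconj]
      definite := fun x hx => by
        by_contra h
        have := hpos x h
        rw [hx] at this
        simp at this }
  let _ : NormedAddCommGroup V := core.toNormedAddCommGroup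
  let _ : InnerProductSpace ℂ V := InnerProductSpace.ofCore core.toCore
  let b := (stdOrthonormalBasis ℂ V).reindex (finCongr hg)
  refine ⟨b.toBasis, fun i j => ?_⟩
  have h := orthonormal_iff_ite.1 b.orthonormal j i
  simp only [eq_comm (a := j)] at h
  rw [b.coe_toBasis]
  exact h

/-- An orthonormal family with as many members as the dimension is a basis. -/
theorem exists_basis_of_orthonormal [FiniteDimensional ℂ V] {g : ℕ} (hg : Module.finrank ℂ V = g)
    (N : V → V → ℂ) (hadd : ∀ x y z, N (x + y) z = N x z + N y z)
    (hsmul : ∀ (c : ℂ) x y, N (c • x) y = c * N x y) (v : Fin g → V)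
    (hv : ∀ i j, N (v i) (v j) = if i = j then 1 else 0) :
    ∃ b : Module.Basis (Fin g) ℂ V, ∀ i, b i = v i := by
  let φ : V → V →ₗ[ℂ] ℂ := fun y =>
    { toFun := fun x => N x y
      map_add' := fun x x' => hadd x x' y
      map_smul' := fun c x => hsmul c x y }
  have hli : LinearIndependent ℂ v := by
    rw [Fintype.linearIndependent_iff]
    intro c hc j
    have h := congrArg (φ (v j)) hc
    rw [map_sum, map_zero] at h
    have h1 : ∀ i, φ (v j) (c i • v i) = if i = j then c i else 0 := by
      intro i
      rw [map_smul]
      change c i * N (v i) (v j) = _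
      rw [hv]
      split_ifs <;> simp
    simpa [h1] using h
  exact ⟨Module.Basis.mk hli (hli.span_eq_top_of_card_eq_finrank' (by simp [hg])).ge,
    fun i => Module.Basis.mk_apply _ _ i⟩

end Hermitian

/-! ### The form weighted by `log |f|` is not a multiple of the inner product -/

section Weighted

variable {C : Type*} [TopologicalSpace C] [ChartedSpace ℂ C] {f : C → OnePoint ℂ}

theorem IsWeight.weightedInner_sum [CompactSpace C] [T2Space C] {u : C → ℝ} (hu : IsWeight u)
    {ι : Type*} [Fintype ι]
    (x y : ι → ℂ) (v : ι → holForms C) :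
    weightedInner u (∑ j, x j • v j) (∑ k, y k • v k) =
      ∑ j, ∑ k, x j * (starRingEnd ℂ) (y k) * weightedInner u (v j) (v k) := by
  let φ : holForms C → holForms C →ₗ[ℂ] ℂ := fun b =>
    { toFun := fun a => weightedInner u a b
      map_add' := fun a a' => hu.weightedInner_add_left a a' b
      map_smul' := fun c a => weightedInner_smul_left u c a b }
  have hl : ∀ (x : ι → ℂ) (b : holForms C), weightedInner u (∑ j, x j • v j) b =
      ∑ j, x j * weightedInner u (v j) b := by
    intro x b
    have h := map_sum (φ b) (fun j => x j • v j) Finset.univ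
    refine h.trans (Finset.sum_congr rfl fun j _ => ?_)
    exact weightedInner_smul_left u (x j) (v j) b
  rw [hl]
  refine Finset.sum_congr rfl fun j _ => ?_
  rw [← weightedInner_conj_symm, hl, map_sum, Finset.mul_sum]
  refine Finset.sum_congr rfl fun k _ => ?_
  rw [map_mul, weightedInner_conj_symm, mul_assoc]

theorem weightedInner_one_pos [IsManifold 𝓘(ℂ) 1 C] [CompactSpace C] [T2Space C]
    [ConnectedSpace C] {a : holForms C} (ha : a ≠ 0) :
    0 < (weightedInner (fun _ => 1) a a).re := by
  obtain ⟨p, hp⟩ := eventually_holForm_ne_zero ha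
  exact (isWeight_one.isIntegrable a a).re_pos a (fun _ => 1) finite_empty (fun _ _ => rfl)
    (fun _ _ => zero_le_one) (hp.mono fun q hq => ⟨one_pos, hq⟩)

/-- By the maximum principle, `|f|` is not locally constant. -/
theorem IsHolomorphicToSphere.frequently_norm_ne [IsManifold 𝓘(ℂ) 1 C] [T2Space C]
    (hf : IsHolomorphicToSphere f)
    (hfin : ∀ x, (f ⁻¹' {x}).Finite) {S : Set C} (hS : S.Finite)
    (hpole : ∀ p, f p = OnePoint.infty → p ∈ S) (r : ℝ) (p : C) :
    ∃ᶠ q in 𝓝 p, q ∉ S ∧ ‖sphereCoord (f q)‖ ≠ r := by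
  intro h
  have h1 : ∀ᶠ q in 𝓝 p, q ∉ S → ‖sphereCoord (f q)‖ = r := by
    filter_upwards [h] with q hq hqS
    by_contra hne
    exact hq ⟨hqS, hne⟩
  obtain ⟨q, hq, hqS⟩ := (infinite_of_mem_nhds_surface h1.eventually_nhds).exists_notMem_finite hS
  have h2 : ∀ᶠ x in 𝓝 q, ‖sphereCoord (f x)‖ = r := by
    filter_upwards [hq, hS.isClosed.isOpen_compl.mem_nhds hqS] with x hx hxS using hx hxS
  set e := chartAt ℂ q
  have hz : e q ∈ e.target := mem_chart_target ℂ q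
  have hqs : e.symm (e q) = q := e.left_inv (mem_chart_source ℂ q)
  have hqi : f (e.symm (e q)) ≠ OnePoint.infty := by
    rw [hqs]
    exact fun h => hqS (hpole q h)
  refine hf.not_eventually_sphereCoord_eq hfin hz hqi (sphereCoord (f (e.symm (e q)))) ?_
  refine Complex.eventually_eq_of_isLocalMax_norm
    (f := fun w => sphereCoord (f (e.symm w))) ?_ ?_
  · exact (hf.analyticAt_sphereCoord (chart_mem_atlas ℂ q) hz hqi).eventually_analyticAt.mono
      fun w hw => hw.differentiableAt
  · rw [← hqs] at h2
    filter_upwards [(e.symm.continuousAt hz).eventually h2] with w hw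
    exact (hw.trans h2.self_of_nhds.symm).le

/-- The functions `log r - c` and `r ^ 2 - exp c ^ 2` of `r > 0` have the same sign. -/
theorem log_sub_mul_sq_sub_pos {r c : ℝ} (hr : 0 < r) (hne : r ≠ Real.exp c) :
    0 < (Real.log r - c) * (r ^ 2 - Real.exp c ^ 2) := by
  have hc := Real.exp_pos c
  rcases lt_or_gt_of_ne hne with h | h
  · refine mul_pos_of_neg_of_neg (sub_neg.2 ((Real.log_lt_iff_lt_exp hr).2 h)) (sub_neg.2 ?_)
    exact pow_lt_pow_left₀ h hr.le two_ne_zero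
  · refine mul_pos (sub_pos.2 ((Real.lt_log_iff_exp_lt hr).2 h)) (sub_pos.2 ?_)
    exact pow_lt_pow_left₀ h hc.le two_ne_zero

/-- The Hermitian form weighted by `log |f|` is not a multiple of the inner product. Indeed, let
`ζ = f η`. If the form were `c` times the inner product, then
`∫ (log |f| - c) (|f| ^ 2 - exp c ^ 2) η ∧ conj η` would be zero, but its integrand has a sign. -/
theorem IsHolomorphicToSphere.exists_weightedInner_ne [IsManifold 𝓘(ℂ) 1 C]
    [CompactSpace C] [T2Space C] [ConnectedSpace C]
    (hf : IsHolomorphicToSphere f) (hcard : ∀ x, (f ⁻¹' {x}).encard ≤ 2) {w : C}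
    (hw : f ⁻¹' {OnePoint.infty} = {w}) (hrank : 2 ≤ Module.finrank ℂ (holForms C)) (c : ℝ) :
    ∃ a : holForms C, weightedInner (fun p => logAbs (f p)) a a ≠
      c * weightedInner (fun _ => 1) a a := by
  by_contra! hall
  have hfin : ∀ x, (f ⁻¹' {x}).Finite := fun x =>
    finite_of_encard_le_coe (k := 2) (by simpa using hcard x)
  obtain ⟨η, ζ, hη, hζ⟩ := hf.exists_holForms_mul hcard hw hrank
  set L : C → ℝ := fun p => logAbs (f p) with hL
  have hLw : IsWeight L := hf.isWeight_logAbs hfin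
  set m : ℂ := ((Real.exp c ^ 2 : ℝ) : ℂ) with hm
  set β : TwoForm C := (weightedForm L ζ ζ + (-c : ℂ) • weightedForm (fun _ => 1) ζ ζ) +
    (-m) • (weightedForm L η η + (-c : ℂ) • weightedForm (fun _ => 1) η η) with hβ
  have hint : ∀ a, (weightedForm L a a + (-c : ℂ) • weightedForm (fun _ => 1) a a).IsIntegrable :=
    fun a => (hLw.isIntegrable a a).add ((isWeight_one.isIntegrable a a).smul _)
  have hzero : ∀ a, Complex.I / 2 *
      (weightedForm L a a + (-c : ℂ) • weightedForm (fun _ => 1) a a).integral = 0 := by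
    intro a
    have h := hall a
    rw [weightedInner, weightedInner] at h
    rw [TwoForm.integral_add (hLw.isIntegrable a a) ((isWeight_one.isIntegrable a a).smul _),
      TwoForm.integral_smul]
    linear_combination h
  have hβ0 : Complex.I / 2 * β.integral = 0 := by
    rw [hβ, TwoForm.integral_add (hint ζ) ((hint η).smul _), TwoForm.integral_smul]
    linear_combination hzero ζ - m * hzero η
  set u : C → ℝ := fun p => (Real.log ‖sphereCoord (f p)‖ - c) *
    (‖sphereCoord (f p)‖ ^ 2 - Real.exp c ^ 2) with hu
  set S : Set C := f ⁻¹' {OnePoint.infty} ∪ f ⁻¹' {((0 : ℂ) : OnePoint ℂ)} with hS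
  have hSfin : S.Finite := (hfin _).union (hfin _)
  have hSne : ∀ p ∉ S, 0 < ‖sphereCoord (f p)‖ := by
    intro p hp
    refine norm_pos_iff.2 fun h => hp ?_
    rcases sphereCoord_eq_zero_iff.1 h with h | h
    exacts [Or.inr h, Or.inl h]
  have hunn : ∀ p ∉ S, 0 ≤ u p := by
    intro p hp
    by_cases h : ‖sphereCoord (f p)‖ = Real.exp c
    · simp [hu, h]
    · exact (log_sub_mul_sq_sub_pos (hSne p hp) h).le
  have heq : ∀ p ∉ S, β p = weightedForm u η η p := by
    intro p hp
    have hpw : p ≠ w := by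
      intro h
      refine hp (Or.inl ?_)
      rw [hw]
      exact h
    ext v
    have h1 : ∀ t : ℝ, (t • wedgeConj (ζ.1 p).toLinearMap (ζ.1 p).toLinearMap) v =
        (t : ℂ) * (‖sphereCoord (f p)‖ ^ 2 : ℝ) *
          (wedgeConj (η.1 p).toLinearMap (η.1 p).toLinearMap) v := by
      intro t
      rw [hζ p hpw]
      change t • ((sphereCoord (f p) * η.1 p (v 0)) *
          (starRingEnd ℂ) (sphereCoord (f p) * η.1 p (v 1)) -
          (sphereCoord (f p) * η.1 p (v 1)) * (starRingEnd ℂ) (sphereCoord (f p) * η.1 p (v 0))) =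
        (t : ℂ) * (‖sphereCoord (f p)‖ ^ 2 : ℝ) *
          (η.1 p (v 0) * (starRingEnd ℂ) (η.1 p (v 1)) -
            η.1 p (v 1) * (starRingEnd ℂ) (η.1 p (v 0)))
      rw [← Complex.normSq_eq_norm_sq, ← Complex.mul_conj, map_mul, map_mul, Complex.real_smul]
      ring
    have h2 : β p v = ((L p • wedgeConj (ζ.1 p).toLinearMap (ζ.1 p).toLinearMap) v +
        (-c : ℂ) * (((1 : ℝ) • wedgeConj (ζ.1 p).toLinearMap (ζ.1 p).toLinearMap) v)) +
        (-m) * ((L p : ℂ) * wedgeConj (η.1 p).toLinearMap (η.1 p).toLinearMap v +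
          (-c : ℂ) * (((1 : ℝ) : ℂ) * wedgeConj (η.1 p).toLinearMap (η.1 p).toLinearMap v)) := rfl
    have h3 : weightedForm u η η p v =
        (u p : ℂ) * wedgeConj (η.1 p).toLinearMap (η.1 p).toLinearMap v := rfl
    rw [h2, h3, h1, h1, hm]
    simp only [hu, hL, logAbs]
    push_cast
    ring
  obtain ⟨p, hp⟩ := eventually_holForm_ne_zero hη
  obtain ⟨q, ⟨hqS, hqne⟩, hq⟩ := ((hf.frequently_norm_ne hfin hSfin (fun p hp => Or.inl hp)
    (Real.exp c) p).and_eventually hp.eventually_nhds).exists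
  have hcont : ContinuousAt (fun x => sphereCoord (f x)) q :=
    (hf.finite_part q fun h => hqS (Or.inl h)).continuousAt
  have hpos := ((hint ζ).add ((hint η).smul (-m))).re_pos η u hSfin heq hunn (p := q) (by
    filter_upwards [hq, hcont.norm.eventually_ne hqne,
      hcont.norm.eventually (lt_mem_nhds (hSne q hqS))] with x hx hx1 hx2
    exact ⟨log_sub_mul_sq_sub_pos hx2 hx1, hx⟩)
  rw [← hβ, hβ0, Complex.zero_re] at hpos
  exact lt_irrefl _ hpos

end Weighted

/-! ### One-forms on the Jacobian and the regulator -/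

section Jacobian

variable {C : Type*} [TopologicalSpace C] [ChartedSpace ℂ C]

theorem free_holForms : Module.Free ℂ (holForms C) :=
  @Module.Free.of_divisionRing ℂ (holForms C) _ _ _

theorem finrank_jacobianOneForm (h : 0 < Module.finrank ℂ (holForms C)) :
    Module.finrank ℂ (JacobianOneForm C) = Module.finrank ℂ (holForms C) := by
  have := free_holForms (C := C)
  have : FiniteDimensional ℂ (holForms C) := FiniteDimensional.of_finrank_pos h
  exact (Subspace.dual_finrank_eq (K := ℂ) (V := Module.Dual ℂ (holForms C))).trans
    (Subspace.dual_finrank_eq (K := ℂ) (V := (holForms C)))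

theorem bijective_eval_holForms (h : 0 < Module.finrank ℂ (holForms C)) :
    Function.Bijective (Module.Dual.eval ℂ (holForms C)) := by
  have := free_holForms (C := C)
  have : Module.Finite ℂ (holForms C) :=
    FiniteDimensional.of_finrank_pos (K := ℂ) (V := holForms C) h
  exact Module.bijective_dual_eval ℂ (holForms C)

/-- Pull-back identifies the one-forms on the Jacobian with those on the curve. -/
noncomputable def pullEquiv (h : 0 < Module.finrank ℂ (holForms C)) :
    JacobianOneForm C ≃ₗ[ℂ] holForms C :=
  (LinearEquiv.ofBijective (Module.Dual.eval ℂ (holForms C)) (bijective_eval_holForms h)).symm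

theorem pullOne_eq [IsManifold 𝓘(ℂ) 1 C] [ConnectedSpace C]
    (h : 0 < Module.finrank ℂ (holForms C)) (p₀ : C) (α : JacobianOneForm C) (p : C) :
    (abelJacobi p₀).pullOne α p = ((pullEquiv h α).1 p).toLinearMap := by
  obtain ⟨η, rfl⟩ := (pullEquiv h).symm.surjective α
  rw [LinearEquiv.apply_symm_apply]
  rfl

theorem formInner_pullOne [IsManifold 𝓘(ℂ) 1 C] [ConnectedSpace C] [CompactSpace C]
    [T2Space C] (h : 0 < Module.finrank ℂ (holForms C)) (p₀ : C)
    (α β : JacobianOneForm C) :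
    formInner ((abelJacobi p₀).pullOne α) ((abelJacobi p₀).pullOne β) =
      weightedInner (fun _ => 1) (pullEquiv h α) (pullEquiv h β) := by
  rw [formInner, weightedInner]
  congr 2
  funext p
  rw [pullOne_eq h, pullOne_eq h, weightedForm, one_smul]

theorem logTimes_pullTwo_tauForm [IsManifold 𝓘(ℂ) 1 C] [ConnectedSpace C]
    (h : 0 < Module.finrank ℂ (holForms C)) (f : C → OnePoint ℂ) (p₀ : C)
        (α β : JacobianOneForm C) :
    logTimes f ((abelJacobi p₀).pullTwo (tauForm α β)) =
      weightedForm (fun p => logAbs (f p)) (pullEquiv h α) (pullEquiv h α) +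
        (-1 : ℂ) • weightedForm (fun p => logAbs (f p)) (pullEquiv h β) (pullEquiv h β) := by
  funext p
  have h1 : (abelJacobi p₀).pullTwo (tauForm α β) p =
      wedgeConj ((abelJacobi p₀).pullOne α p) ((abelJacobi p₀).pullOne α p) -
        wedgeConj ((abelJacobi p₀).pullOne β p) ((abelJacobi p₀).pullOne β p) := rfl
  rw [logTimes, h1, pullOne_eq h, pullOne_eq h]
  simp only [Pi.add_apply, Pi.smul_apply, weightedForm]
  rw [smul_sub, neg_one_smul, sub_eq_add_neg]

variable [CompactSpace C] [T2Space C]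

/-- The Gram matrix of a family of one-forms with respect to the form with weight `u`. -/
noncomputable def gramMatrix {ι : Type*} (u : C → ℝ) (v : ι → holForms C) : Matrix ι ι ℂ :=
  Matrix.of fun j k => weightedInner u (v j) (v k)

theorem isHermitian_gramMatrix {ι : Type*} (u : C → ℝ) (v : ι → holForms C) :
    (gramMatrix u v).IsHermitian := by
  ext j k
  exact weightedInner_conj_symm u (v j) (v k)

/-- A change of basis by `U` turns a Gram matrix `H` into `U H Uᴴ`. -/
theorem weightedInner_combination {ι : Type*} [Fintype ι] {u : C → ℝ}
    (hu : IsWeight u) (v : ι → holForms C) (U : Matrix ι ι ℂ) (i k : ι) :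
    weightedInner u (∑ j, U i j • v j) (∑ j, U k j • v j) = (U * gramMatrix u v * star U) i k := by
  rw [hu.weightedInner_sum]
  simp only [Matrix.mul_apply, Finset.sum_mul, Matrix.star_apply, gramMatrix, Matrix.of_apply]
  rw [Finset.sum_comm]
  refine Finset.sum_congr rfl fun j _ => Finset.sum_congr rfl fun l _ => ?_
  change _ * star (U k j) * _ = _
  ring

variable [IsManifold 𝓘(ℂ) 1 C] [ConnectedSpace C]

/-- The two components of the basic cycle contribute equally to the regulator, since the two-form
is invariant under translations. -/
theorem realRegulator_basicCycle_tauForm (f : C → OnePoint ℂ) (w₁ w₂ : C)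
    (α β : JacobianOneForm C) :
    realRegulator (basicCycle f w₁ w₂) (tauForm α β) = 2 * (2 * Real.pi * Complex.I)⁻¹ *
      (logTimes f ((abelJacobi w₁).pullTwo (tauForm α β))).integral := by
  have h1 : ((abelJacobi w₁).translate ((abelJacobi w₁).toFun w₂)).pullTwo (tauForm α β) =
      (abelJacobi w₁).pullTwo (tauForm α β) := rfl
  rw [basicCycle, map_add, Pi.add_apply, realRegulator, FreeAbelianGroup.lift_apply_of,
    FreeAbelianGroup.lift_apply_of, h1]
  ring

theorem realRegulator_ne_zero_iff_integral (f : C → OnePoint ℂ) (w₁ w₂ : C)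
    (α β : JacobianOneForm C) :
    realRegulator (basicCycle f w₁ w₂) (tauForm α β) ≠ 0 ↔
      (logTimes f ((abelJacobi w₁).pullTwo (tauForm α β))).integral ≠ 0 := by
  rw [realRegulator_basicCycle_tauForm, mul_ne_zero_iff, and_iff_right]
  exact mul_ne_zero two_ne_zero (inv_ne_zero Complex.two_pi_I_ne_zero)

theorem realRegulator_ne_zero_iff (h : 0 < Module.finrank ℂ (holForms C)) {f : C → OnePoint ℂ}
    (hL : IsWeight fun p => logAbs (f p)) (w₁ w₂ : C) (α β : JacobianOneForm C) :
    realRegulator (basicCycle f w₁ w₂) (tauForm α β) ≠ 0 ↔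
      weightedInner (fun p => logAbs (f p)) (pullEquiv h α) (pullEquiv h α) ≠
        weightedInner (fun p => logAbs (f p)) (pullEquiv h β) (pullEquiv h β) := by
  rw [realRegulator_ne_zero_iff_integral, logTimes_pullTwo_tauForm h,
    TwoForm.integral_add (hL.isIntegrable _ _) ((hL.isIntegrable _ _).smul _),
    TwoForm.integral_smul, weightedInner, weightedInner, not_iff_not,
    mul_right_inj' (div_ne_zero Complex.I_ne_zero two_ne_zero), neg_one_mul, ← sub_eq_add_neg,
    sub_eq_zero]

/-- With respect to an orthonormal family which spans, the Gram matrix of the form weighted by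
`log |f|` is not scalar. -/
theorem gramMatrix_ne_smul_one {g : ℕ} {f : C → OnePoint ℂ} (hf : IsHolomorphicToSphere f)
    (hcard : ∀ x, (f ⁻¹' {x}).encard ≤ 2) {w : C} (hw : f ⁻¹' {OnePoint.infty} = {w})
    (hrank : 2 ≤ Module.finrank ℂ (holForms C)) (v : Fin g → holForms C)
    (hspan : ∀ a, ∃ x : Fin g → ℂ, a = ∑ j, x j • v j)
    (hv : gramMatrix (fun _ => 1) v = 1) (c : ℝ) :
    gramMatrix (fun p => logAbs (f p)) v ≠ (c : ℂ) • (1 : Matrix (Fin g) (Fin g) ℂ) := by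
  intro hc
  have hfin : ∀ x, (f ⁻¹' {x}).Finite := fun x =>
    finite_of_encard_le_coe (k := 2) (by simpa using hcard x)
  obtain ⟨a, ha⟩ := hf.exists_weightedInner_ne hcard hw hrank c
  obtain ⟨x, rfl⟩ := hspan a
  apply ha
  rw [(hf.isWeight_logAbs hfin).weightedInner_sum, isWeight_one.weightedInner_sum, Finset.mul_sum]
  refine Finset.sum_congr rfl fun j _ => ?_
  rw [Finset.mul_sum]
  refine Finset.sum_congr rfl fun k _ => ?_
  have h1 : weightedInner (fun p => logAbs (f p)) (v j) (v k) =
      c * weightedInner (fun _ => 1) (v j) (v k) := by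
    have h2 := congrFun (congrFun hc j) k
    have h3 := congrFun (congrFun hv j) k
    simp only [gramMatrix, Matrix.of_apply, Matrix.smul_apply, smul_eq_mul] at h2 h3
    rw [h2, h3]
  rw [h1]
  ring

end Jacobian

end RiemannSurface

theorem proposition2p4p1 {C : Type*} [TopologicalSpace C] [ChartedSpace ℂ C]
    [IsManifold 𝓘(ℂ) 1 C] [CompactSpace C] [T2Space C] [ConnectedSpace C]
    (g : ℕ) (hg : 2 ≤ g) (hgenus : Module.finrank ℂ (holForms C) = g)
    (f : C → OnePoint ℂ) (hf : IsDoubleCover f) (w₁ w₂ : C)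
    (hw₁ : f ⁻¹' {((0 : ℂ) : OnePoint ℂ)} = {w₁}) (hw₂ : f ⁻¹' {OnePoint.infty} = {w₂}) :
    (∃ ω : Module.Basis (Fin g) ℂ (JacobianOneForm C), IsOrthonormalFrame w₁ ω ∧
      realRegulator (basicCycle f w₁ w₂) (tauForm (ω ⟨0, by omega⟩) (ω ⟨1, by omega⟩)) ≠ 0) ∧
    ∀ ω : Module.Basis (Fin g) ℂ (JacobianOneForm C), IsOrthonormalFrame w₁ ω →
      (logTimes f ((abelJacobi w₁).pullTwo
        (tauForm (ω ⟨0, by omega⟩) (ω ⟨1, by omega⟩)))).IsIntegrable ∧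
      (realRegulator (basicCycle f w₁ w₂) (tauForm (ω ⟨0, by omega⟩) (ω ⟨1, by omega⟩)) ≠ 0 ↔
        (logTimes f ((abelJacobi w₁).pullTwo
          (tauForm (ω ⟨0, by omega⟩) (ω ⟨1, by omega⟩)))).integral ≠ 0) ∧
      IsOpen {U : Matrix.unitaryGroup (Fin g) ℂ | realRegulator (basicCycle f w₁ w₂)
        (tauForm (∑ j, U.1 ⟨0, by omega⟩ j • ω j) (∑ j, U.1 ⟨1, by omega⟩ j • ω j)) ≠ 0} ∧
      Dense {U : Matrix.unitaryGroup (Fin g) ℂ | realRegulator (basicCycle f w₁ w₂)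
        (tauForm (∑ j, U.1 ⟨0, by omega⟩ j • ω j) (∑ j, U.1 ⟨1, by omega⟩ j • ω j)) ≠ 0} := by
  have hpos : 0 < Module.finrank ℂ (holForms C) := by omega
  have hrank : 2 ≤ Module.finrank ℂ (holForms C) := by omega
  have hfin : ∀ x, (f ⁻¹' {x}).Finite := fun x =>
    finite_of_encard_le_coe (k := 2) (by simpa using hf.fibre_le x)
  have hL := hf.holomorphic.isWeight_logAbs hfin
  have hrankJ := (finrank_jacobianOneForm hpos).trans hgenus
  set N : JacobianOneForm C → JacobianOneForm C → ℂ := fun α β =>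
    weightedInner (fun _ => 1) (pullEquiv hpos α) (pullEquiv hpos β) with hN
  have hNadd : ∀ x y z, N (x + y) z = N x z + N y z := by
    intro x y z
    simp only [hN, map_add]
    exact isWeight_one.weightedInner_add_left _ _ _
  have hNsmul : ∀ (c : ℂ) x y, N (c • x) y = c * N x y := by
    intro c x y
    simp only [hN, map_smul]
    exact weightedInner_smul_left _ _ _ _
  have hframe : ∀ ω : Fin g → JacobianOneForm C, IsOrthonormalFrame w₁ ω ↔
      ∀ i j, N (ω i) (ω j) = if i = j then 1 else 0 := by
    intro ω
    simp only [IsOrthonormalFrame, formInner_pullOne hpos, hN]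
  have hcomb : ∀ (ω : Fin g → JacobianOneForm C) (U : Matrix (Fin g) (Fin g) ℂ) (i : Fin g),
      pullEquiv hpos (∑ j, U i j • ω j) = ∑ j, U i j • pullEquiv hpos (ω j) := by
    intro ω U i
    rw [map_sum]
    exact Finset.sum_congr rfl fun j _ => map_smul _ _ _
  have hone : ∀ ω : Module.Basis (Fin g) ℂ (JacobianOneForm C), IsOrthonormalFrame w₁ ω →
      gramMatrix (fun _ => 1) (fun i => pullEquiv hpos (ω i)) = 1 := by
    intro ω hω
    ext i j
    rw [Matrix.one_apply]
    exact (hframe ω).1 hω i j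
  have hns : ∀ ω : Module.Basis (Fin g) ℂ (JacobianOneForm C), IsOrthonormalFrame w₁ ω →
      ∀ c : ℝ, gramMatrix (fun p => logAbs (f p)) (fun i => pullEquiv hpos (ω i)) ≠
        (c : ℂ) • (1 : Matrix (Fin g) (Fin g) ℂ) := by
    intro ω hω
    refine gramMatrix_ne_smul_one hf.holomorphic hf.fibre_le hw₂ hrank _ ?_ (hone ω hω)
    intro a
    refine ⟨fun j => ω.repr ((pullEquiv hpos).symm a) j, ?_⟩
    have h1 := congrArg (pullEquiv hpos) (ω.sum_repr ((pullEquiv hpos).symm a))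
    rw [LinearEquiv.apply_symm_apply, map_sum] at h1
    refine h1.symm.trans (Finset.sum_congr rfl fun j _ => map_smul _ _ _)
  have hreg : ∀ (ω : Fin g → JacobianOneForm C) (U : Matrix.unitaryGroup (Fin g) ℂ) (i j : Fin g),
      realRegulator (basicCycle f w₁ w₂)
        (tauForm (∑ k, U.1 i k • ω k) (∑ k, U.1 j k • ω k)) ≠ 0 ↔
      (U.1 * gramMatrix (fun p => logAbs (f p)) (fun i => pullEquiv hpos (ω i)) * star U.1) i i ≠
        (U.1 * gramMatrix (fun p => logAbs (f p)) (fun i => pullEquiv hpos (ω i)) *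
          star U.1) j j := by
    intro ω U i j
    rw [realRegulator_ne_zero_iff hpos hL, hcomb, hcomb, weightedInner_combination hL,
      weightedInner_combination hL]
  have h01 : (⟨0, by omega⟩ : Fin g) ≠ ⟨1, by omega⟩ := by simp
  refine ⟨?_, fun ω hω => ⟨?_, ?_, ?_, ?_⟩⟩
  · -- rotate any orthonormal basis by a unitary matrix which separates two diagonal entries
    have : FiniteDimensional ℂ (JacobianOneForm C) := FiniteDimensional.of_finrank_pos (by omega)
    obtain ⟨ω, hω⟩ := exists_orthonormal_basis hrankJ N hNadd hNsmul
      (fun x y => weightedInner_conj_symm _ _ _)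
      (fun x hx => weightedInner_one_pos fun h => hx ((pullEquiv hpos).map_eq_zero_iff.1 h))
    have hω' := (hframe ω).2 hω
    obtain ⟨U, hU⟩ := Matrix.exists_unitary_diag_ne (isHermitian_gramMatrix _ _) (hns ω hω') h01
    obtain ⟨b, hb⟩ := exists_basis_of_orthonormal hrankJ N hNadd hNsmul
      (fun i => ∑ k, U.1 i k • ω k) (by
        intro i j
        simp only [hN, hcomb]
        rw [weightedInner_combination isWeight_one, hone ω hω', mul_one]
        have h2 : U.1 * star U.1 = 1 := Unitary.coe_mul_star_self U
        rw [h2, Matrix.one_apply])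
    have hbfun : (b : Fin g → JacobianOneForm C) = fun i => ∑ k, U.1 i k • ω k := funext hb
    refine ⟨b, (hframe b).2 ?_, ?_⟩
    · intro i j
      rw [hb, hb]
      simp only [hN, hcomb]
      rw [weightedInner_combination isWeight_one, hone ω hω', mul_one]
      have h2 : U.1 * star U.1 = 1 := Unitary.coe_mul_star_self U
      rw [h2, Matrix.one_apply]
    · rw [hb, hb]
      exact (hreg ω U _ _).2 hU
  · rw [logTimes_pullTwo_tauForm hpos]
    exact (hL.isIntegrable _ _).add ((hL.isIntegrable _ _).smul _)
  · exact realRegulator_ne_zero_iff_integral f w₁ w₂ _ _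
  · simp only [hreg]
    exact Matrix.isOpen_unitary_diag_ne _ _ _
  · simp only [hreg]
    exact Matrix.dense_unitary_diag_ne (isHermitian_gramMatrix _ _) (hns ω hω) h01
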